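/- Let $M$ be a smooth real $n$-dimensional manifold and let $L:TM\to TM$ be an operator field, i.e. a smooth $(1,1)$ tensor field. Put $$T_L(X,Y)=L^2[X,Y]+[LX,LY]-L\big([X,LY]+[LX,Y]\big),$$ $$H_L(X,Y)=L^2T_L(X,Y)+T_L(LX,LY)-L\big(T_L(X,LY)+T_L(LX,Y)\big)$$ (the Nijenhuis and Haantjes torsions of $L$). Assume that at every point all eigenvalues of $L$ are real, that they are given by continuous functions $l_1,\dots,l_s:M\to\mathbb R$ which are pointwise distinct ($l_i(x)\ne l_j(x)$ for all $x\in M$ and $i\neq j$), and that each generalized eigen-distribution $\mathcal D_i(x)=\bigcup_{\rho\ge 1}\ker(L_x-l_i(x)I)^\rho$ has rank $r_i$ independent of $x\in M$. A frame on an open set $U\subseteq M$ is an $n$-tuple of smooth vector fields on $U$ forming a basis of $T_xM$ at each $x\in U$. Two frames $(X_k)$, $(Y_k)$ on $U$ are equivalent if $X_k=f_kY_k$ for all $k$, with smooth nowhere vanishing functions $f_k$ on $U$. A frame on $U$ is integrable if every point of $U$ has an open neighbourhood in $U$ on which the frame is equivalent to the natural frame $(\partial/\partial x^1,\dots,\partial/\partial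 x^n)$ of a smooth chart. A frame is an eigen-frame (resp. a generalized eigen-frame) of $L$ if its members are eigenvectors (resp. generalized eigenvectors) of $L$ at each point. $L$ is semisimple if every point has an open neighbourhood carrying an eigen-frame of $L$, and simple if it has $n$ distinct real eigenvalues at every point. Then: 1. If $H_L=0$, then around every point of $M$ there is a chart with domain $U$ and an ordered partition of $\{1,\dots,n\}$ into consecutive blocks $B_1,\dots,B_s$ such that every frame $(Y_k)$ on $U$ equivalent to the natural frame of the chart (in particular the natural frame itself) is an integrable generalized eigen-frame of $L$ with $\mathcal D_i(x)=\operatorname{span}\{Y_k(x):k\in B_i\}$ for all $x\in U$ and all $i$, and the matrix of $L$ in this frame is block-diagonal with blocks $B_1,\dots,B_s$. If in addition $L$ is semisimple, this matrix is diagonal. 2. If $L$ is semisimple, then the following are equivalent: $H_L=0$; around every point of $M$ there is a chart in whose natural frame $L$ is diagonal; every point of $M$ has an open neighbourhood carrying an integrable generalized eigen-frame of $L$. 3. If $L$ is simple and $H_L=0$, then every eigen-frame of $L$ on any open subset of $M$ is integrable. -/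

import Mathlib

open scoped Manifold ContDiff

namespace Haantjes

/-- The model space `ℝⁿ`. -/
abbrev Coord (n : ℕ) : Type := EuclideanSpace ℝ (Fin n)

/-- An arbitrary (not necessarily smooth) assignment of a tangent vector to each point. -/
abbrev VField (n : ℕ) (M : Type*) [TopologicalSpace M] [ChartedSpace (Coord n) M] : Type _ :=
  (x : M) → TangentSpace (𝓡 n) x

/-- A smooth vector field on the set `U` (values outside `U` are irrelevant). -/
def SmoothOn {n : ℕ} {M : Type*} [TopologicalSpace M] [ChartedSpace (Coord n) M]
    [IsManifold (𝓡 n) ∞ M] (X : VField n M) (U : Set M) : Prop :=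
  ContMDiffOn (𝓡 n) (𝓡 n).tangent ∞ (fun x => (⟨x, X x⟩ : TangentBundle (𝓡 n) M)) U

/-- An operator field: a smooth `(1,1)` tensor field, i.e. a smooth section of the bundle
`End(TM)`. -/
structure OperatorField (n : ℕ) (M : Type*) [TopologicalSpace M] [ChartedSpace (Coord n) M]
    [IsManifold (𝓡 n) ∞ M] where
  /-- The endomorphism of the tangent space at each point. -/
  op : (x : M) → TangentSpace (𝓡 n) x →L[ℝ] TangentSpace (𝓡 n) x
  smooth : ContMDiff (𝓡 n) ((𝓡 n).prod 𝓘(ℝ, Coord n →L[ℝ] Coord n)) ∞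
    (fun x => Bundle.TotalSpace.mk' (Coord n →L[ℝ] Coord n)
      (E := fun x : M => TangentSpace (𝓡 n) x →L[ℝ] TangentSpace (𝓡 n) x) x (op x))

section

variable {n : ℕ} {M : Type*} [TopologicalSpace M] [ChartedSpace (Coord n) M]
  [IsManifold (𝓡 n) ∞ M]

/-- `L` at `x`, as an algebraic endomorphism of the tangent space. -/
noncomputable def OperatorField.endAt (L : OperatorField n M) (x : M) :
    Module.End ℝ (TangentSpace (𝓡 n) x) :=
  (L.op x).toLinearMap

/-- The vector field `L X`. -/
noncomputable def OperatorField.apply (L : OperatorField n M) (X : VField n M) : VField n M :=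
  fun x => L.op x (X x)

/-- The Nijenhuis torsion
`T_L(X,Y) = L²[X,Y] + [LX,LY] - L([X,LY] + [LX,Y])`. -/
noncomputable def nijenhuisTorsion (L : OperatorField n M) (X Y : VField n M) : VField n M :=
  L.apply (L.apply (VectorField.mlieBracket (𝓡 n) X Y))
    + VectorField.mlieBracket (𝓡 n) (L.apply X) (L.apply Y)
    - L.apply (VectorField.mlieBracket (𝓡 n) X (L.apply Y)
        + VectorField.mlieBracket (𝓡 n) (L.apply X) Y)

/-- The Haantjes torsion
`H_L(X,Y) = L² T_L(X,Y) + T_L(LX,LY) - L(T_L(X,LY) + T_L(LX,Y))`. -/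
noncomputable def haantjesTorsion (L : OperatorField n M) (X Y : VField n M) : VField n M :=
  L.apply (L.apply (nijenhuisTorsion L X Y))
    + nijenhuisTorsion L (L.apply X) (L.apply Y)
    - L.apply (nijenhuisTorsion L X (L.apply Y) + nijenhuisTorsion L (L.apply X) Y)

/-- The Haantjes torsion of `L` vanishes identically. As it is a tensor field, it is tested
on all smooth vector fields defined on open sets. -/
def IsHaantjes (L : OperatorField n M) : Prop :=
  ∀ (U : Set M) (X Y : VField n M), IsOpen U → SmoothOn X U → SmoothOn Y U →
    ∀ x ∈ U, haantjesTorsion L X Y x = 0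

/-- The generalized eigenspace `⋃ ρ, ker (L - μ I)^ρ` of `L` at `x`; it equals
`ker (L - μ I)^ρ` for `ρ` the Riesz index of `μ`, and is `0` when `μ` is not an eigenvalue. -/
noncomputable def genEigenspace (L : OperatorField n M) (x : M) (μ : ℝ) :
    Submodule ℝ (TangentSpace (𝓡 n) x) :=
  Module.End.maxGenEigenspace (L.endAt x) μ

/-- A reference frame on the open set `U`: `n` smooth vector fields on `U` that form a basis
of the tangent space at each point of `U`. -/
structure IsFrame (Y : Fin n → VField n M) (U : Set M) : Prop where
  isOpen : IsOpen U
  smooth : ∀ k, SmoothOn (Y k) U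
  linearIndependent : ∀ x ∈ U, LinearIndependent ℝ (fun k => Y k x)
  span_eq_top : ∀ x ∈ U, Submodule.span ℝ (Set.range fun k => Y k x) = ⊤

/-- Two frames on `U` are equivalent if they agree up to smooth nowhere vanishing factors. -/
def EquivFrames (X Y : Fin n → VField n M) (U : Set M) : Prop :=
  ∃ f : Fin n → M → ℝ, (∀ k, ContMDiffOn (𝓡 n) 𝓘(ℝ, ℝ) ∞ (f k) U) ∧
    ∀ k, ∀ x ∈ U, f k x ≠ 0 ∧ X k x = f k x • Y k x

/-- The natural frame `∂/∂x¹, …, ∂/∂xⁿ` of a chart `φ`: the pullback under `φ` of the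
constant frame `e₁, …, eₙ` of `ℝⁿ`, i.e. `(dφ)⁻¹ eₖ`; meaningful on `φ.source`. -/
noncomputable def naturalFrame (φ : OpenPartialHomeomorph M (Coord n)) (k : Fin n) :
    VField n M :=
  VectorField.mpullback (𝓡 n) 𝓘(ℝ, Coord n) φ
    (fun _ => (EuclideanSpace.single k (1 : ℝ) : Coord n))

/-- `φ` is a smooth local chart of `M` whose domain contains `x`. -/
def IsChartAt (φ : OpenPartialHomeomorph M (Coord n)) (x : M) : Prop :=
  φ ∈ IsManifold.maximalAtlas (𝓡 n) ∞ M ∧ x ∈ φ.source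

/-- A frame on `U` is integrable if near each point of `U` it is equivalent to the
natural frame of a local chart. -/
def IsIntegrableFrame (Y : Fin n → VField n M) (U : Set M) : Prop :=
  IsFrame Y U ∧ ∀ x ∈ U, ∃ φ : OpenPartialHomeomorph M (Coord n),
    IsChartAt φ x ∧ φ.source ⊆ U ∧ EquivFrames Y (naturalFrame φ) φ.source

/-- An eigen-frame of `L` on `U`: a frame of (proper) eigenvector fields. -/
def IsEigenFrame (L : OperatorField n M) (Y : Fin n → VField n M) (U : Set M) : Prop :=
  IsFrame Y U ∧ ∀ x ∈ U, ∀ k, ∃ μ : ℝ, Module.End.HasEigenvector (L.endAt x) μ (Y k x)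

/-- A generalized eigen-frame of `L` on `U`: a frame of generalized eigenvector fields. -/
def IsGenEigenFrame (L : OperatorField n M) (Y : Fin n → VField n M) (U : Set M) : Prop :=
  IsFrame Y U ∧ ∀ x ∈ U, ∀ k, ∃ μ : ℝ, Y k x ∈ genEigenspace L x μ

/-- `A x` is the matrix of `L` at `x` in the frame `Y`, for all `x ∈ U`. -/
def IsMatrixIn (L : OperatorField n M) (Y : Fin n → VField n M) (U : Set M)
    (A : M → Matrix (Fin n) (Fin n) ℝ) : Prop :=
  ∀ x ∈ U, ∀ k, L.op x (Y k x) = ∑ j, A x j k • Y j x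

/-- `L` takes a block-diagonal form in the frame `Y` on `U`, the block of the index `k` being
`p k`. -/
def IsBlockDiagonalIn {s : ℕ} (L : OperatorField n M) (Y : Fin n → VField n M) (U : Set M)
    (p : Fin n → Fin s) : Prop :=
  ∃ A : M → Matrix (Fin n) (Fin n) ℝ, IsMatrixIn L Y U A ∧
    ∀ x ∈ U, ∀ j k, p j ≠ p k → A x j k = 0

/-- `L` takes a diagonal form in the frame `Y` on `U`. -/
def IsDiagonalIn (L : OperatorField n M) (Y : Fin n → VField n M) (U : Set M) : Prop :=
  ∃ A : M → Matrix (Fin n) (Fin n) ℝ, IsMatrixIn L Y U A ∧ ∀ x ∈ U, (A x).IsDiag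

/-- `L` is semisimple: every point has an open neighbourhood with an eigen-frame of `L`. -/
def IsSemisimpleField (L : OperatorField n M) : Prop :=
  ∀ x : M, ∃ (U : Set M) (Y : Fin n → VField n M), x ∈ U ∧ IsEigenFrame L Y U

/-- `L` is simple: at each point it has `n` distinct real eigenvalues. -/
def IsSimpleField (L : OperatorField n M) : Prop :=
  ∀ x : M, ∃ μ : Fin n → ℝ, Function.Injective μ ∧
    ∀ k, Module.End.HasEigenvalue (L.endAt x) (μ k)

end

end Haantjes

/-! Put `P i = (X - l i) ^ n` and let `Q i` be the product of the `P j` with `j ≠ i`. At each point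
the kernel of `P i (L)` is the generalized eigenspace `D i`, and the kernel of `Q i (L)` equals the
range of `P i (L)`: it is the sum `C i` of the other generalized eigenspaces. Since `D i` is the
intersection of the `C j`, `j ≠ i`, it is enough to find for every `i` functions `f i` with values
in `ℝ ^ r i` such that `ker (d f i) = C i`. The `C i` have intersection `0` and the ranks add up to
`n`, so all these functions together form a chart, and in it `D i` is spanned by the coordinate
fields of the `i`-th block.

By Frobenius such `f i` exist once `C i` is involutive (`cofactor_lieBracket_eq_zero`). For sections
`X`, `Y` of `C i` the vector `Q i (L) [X, Y]` depends only on the values of `X` and `Y`, through a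
bilinear form `β`. Because `Q i (L)` commutes with `L`, it carries `H_L(X, Y)` to an iterated defect
of `β`: twice the failure of `β` to commute with `L` in the first argument and twice in the second.
The values of `β` are killed by `P i (L)`, while `P i (L)` maps `C i` onto itself, so a form of this
kind that commutes with `L` in one argument is zero. If `H_L = 0`, the four defects can be removed
one at a time and `β = 0`.

Two analytic facts are needed. The eigenvalues are smooth, because a root of constant multiplicity
is a simple root of a derivative of the characteristic polynomial (`contDiffOn_root`). The Frobenius
theorem (`exists_first_integrals`) comes from a joint flow of commuting fields, produced by the
inverse function theorem in a Banach space of curves.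

For the converses, generalized eigenvectors of a semisimple `L` are eigenvectors, so an integrable
generalized eigen-frame diagonalizes `L` in charts, where the Haantjes torsion vanishes by direct
computation. If `L` is simple, all blocks have size one, so an eigen-frame is proportional to a
permuted coordinate frame. -/

namespace Haantjes

open Topology Filter Set

/-! ### Inverse function theorem on an open set -/

section LocalInverse

variable {E F : Type*} [NormedAddCommGroup E] [NormedSpace ℝ E] [CompleteSpace E]
  [NormedAddCommGroup F] [NormedSpace ℝ F]

/-- The inverse function theorem, with smoothness on a whole neighbourhood. -/
theorem exists_smooth_local_inverse {H : E → F} {Ω : Set E} (hΩ : IsOpen Ω)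
    (hH : ContDiffOn ℝ ∞ H Ω) {a : E} (ha : a ∈ Ω) (hinv : (fderiv ℝ H a).IsInvertible) :
    ∃ e : OpenPartialHomeomorph E F, a ∈ e.source ∧ e.source ⊆ Ω ∧ (∀ x, e x = H x) ∧
      (∀ x ∈ e.source, (fderiv ℝ H x).IsInvertible) ∧ ContDiffOn ℝ ∞ e.symm e.target := by
  have hne : (∞ : WithTop ℕ∞) ≠ 0 := by simp
  have hHa : ContDiffAt ℝ ∞ H a := hH.contDiffAt (hΩ.mem_nhds ha)
  obtain ⟨f', hf'⟩ := hinv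
  have hd : HasFDerivAt H (f' : E →L[ℝ] F) a := by
    rw [hf']; exact (hHa.differentiableAt hne).hasFDerivAt
  let e₀ := hHa.toOpenPartialHomeomorph H hd hne
  have hcont : ContinuousOn (fderiv ℝ H) Ω := hH.continuousOn_fderiv_of_isOpen hΩ (by simp)
  -- Invertible operators form an open set. Shrinking the source to the points with invertible
  -- derivative makes the inverse smooth on the whole target and not only at the image of `a`.
  have hop : IsOpen (Ω ∩ fderiv ℝ H ⁻¹' range ((↑) : (E ≃L[ℝ] F) → E →L[ℝ] F)) :=
    hcont.isOpen_inter_preimage hΩ ContinuousLinearEquiv.isOpen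
  set s := Ω ∩ fderiv ℝ H ⁻¹' range ((↑) : (E ≃L[ℝ] F) → E →L[ℝ] F)
  have has : a ∈ s := ⟨ha, f', hf'⟩
  refine ⟨e₀.restrOpen s hop, ?_, ?_, fun _ => rfl, ?_, ?_⟩
  · exact ⟨hHa.mem_toOpenPartialHomeomorph_source hd hne, has⟩
  · exact fun x hx => hx.2.1
  · exact fun x hx => hx.2.2
  · intro y hy
    refine ContDiffAt.contDiffWithinAt ?_
    set e := e₀.restrOpen s hop
    have hx : e.symm y ∈ e.source := e.map_target hy
    obtain ⟨g, hg⟩ := hx.2.2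
    have hHx : ContDiffAt ℝ ∞ H (e.symm y) := hH.contDiffAt (hΩ.mem_nhds hx.2.1)
    refine e.contDiffAt_symm (f₀' := g) hy ?_ hHx
    rw [hg]; exact (hHx.differentiableAt hne).hasFDerivAt

end LocalInverse

/-! ### Superposition and integration operators on spaces of continuous functions -/

section Nemytskii

variable {K : Type*} [TopologicalSpace K] [CompactSpace K]

/-- Pointwise evaluation of a continuous family of operators on a continuous family of vectors. -/
noncomputable def pointwiseApply (K : Type*) [TopologicalSpace K] [CompactSpace K]
    (E F : Type*) [NormedAddCommGroup E] [NormedSpace ℝ E] [NormedAddCommGroup F]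
    [NormedSpace ℝ F] : C(K, E →L[ℝ] F) →L[ℝ] C(K, E) →L[ℝ] C(K, F) :=
  LinearMap.mkContinuous₂
    (LinearMap.mk₂ ℝ (fun (A : C(K, E →L[ℝ] F)) (h : C(K, E)) =>
        (⟨fun t => A t (h t), by fun_prop⟩ : C(K, F)))
      (fun A B h => by ext t; simp) (fun c A h => by ext t; simp)
      (fun A h k => by ext t; simp) (fun c A h => by ext t; simp)) 1 (by
    intro A h
    rw [ContinuousMap.norm_le _ (by positivity)]
    intro t
    calc ‖A t (h t)‖ ≤ ‖A t‖ * ‖h t‖ := (A t).le_opNorm _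
      _ ≤ 1 * ‖A‖ * ‖h‖ := by
        rw [one_mul]
        gcongr
        · exact A.norm_coe_le_norm t
        · exact h.norm_coe_le_norm t)

@[simp] theorem pointwiseApply_apply {E F : Type*} [NormedAddCommGroup E] [NormedSpace ℝ E]
    [NormedAddCommGroup F] [NormedSpace ℝ F] (A : C(K, E →L[ℝ] F)) (h : C(K, E)) (t : K) :
    pointwiseApply K E F A h t = A t (h t) := rfl

/-- Evaluation of a continuous family of operators at a fixed vector. -/
noncomputable def constApply (K : Type*) [TopologicalSpace K] [CompactSpace K]
    (E F : Type*) [NormedAddCommGroup E] [NormedSpace ℝ E] [NormedAddCommGroup F]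
    [NormedSpace ℝ F] : C(K, E →L[ℝ] F) →L[ℝ] E →L[ℝ] C(K, F) :=
  LinearMap.mkContinuous₂
    (LinearMap.mk₂ ℝ (fun (A : C(K, E →L[ℝ] F)) (c : E) =>
        (⟨fun t => A t c, by fun_prop⟩ : C(K, F)))
      (fun A B h => by ext t; simp) (fun c A h => by ext t; simp)
      (fun A h k => by ext t; simp) (fun c A h => by ext t; simp)) 1 (by
    intro A h
    rw [ContinuousMap.norm_le _ (by positivity)]
    intro t
    calc ‖A t h‖ ≤ ‖A t‖ * ‖h‖ := (A t).le_opNorm _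
      _ ≤ 1 * ‖A‖ * ‖h‖ := by
        rw [one_mul]
        gcongr
        exact A.norm_coe_le_norm t)

variable {E : Type} [NormedAddCommGroup E] [NormedSpace ℝ E]

/-- Superposition by a `C¹` function is differentiable on the space of continuous functions. -/
theorem hasFDerivAt_superposition {F : Type*} [NormedAddCommGroup F] [NormedSpace ℝ F]
    (f : C(E, F)) (f' : C(E, E →L[ℝ] F)) (hf : ∀ x, HasFDerivAt f (f' x) x) (u : C(K, E)) :
    HasFDerivAt (fun u : C(K, E) => f.comp u) (pointwiseApply K E F (f'.comp u)) u := by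
  rw [hasFDerivAt_iff_isLittleO, Asymptotics.isLittleO_iff]
  intro ε hε
  have hc : Continuous fun v : C(K, E) => f'.comp v := f'.continuous_postcomp
  obtain ⟨δ, hδ, hball⟩ := Metric.mem_nhds_iff.1
    (hc.continuousAt (Metric.ball_mem_nhds (f'.comp u) hε))
  filter_upwards [Metric.ball_mem_nhds u hδ] with v hv
  rw [ContinuousMap.norm_le _ (by positivity)]
  intro t
  -- A point of the segment with parameter `θ` is the value at `t` of the function `u + θ • (v -
  -- u)`, which is as close to `u` as `v` is. Continuity of superposition by `f'` in the sup norm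
  -- therefore bounds `f' y - f' (u t)` uniformly in `t`, and the mean value inequality applies.
  have key : ∀ y ∈ segment ℝ (u t) (v t), ‖f' y - f' (u t)‖ ≤ ε := by
    intro y hy
    rw [segment_eq_image'] at hy
    obtain ⟨θ, hθ, rfl⟩ := hy
    set w : C(K, E) := u + θ • (v - u)
    have hw : dist w u < δ := by
      rw [dist_eq_norm]
      have : w - u = θ • (v - u) := by simp [w]
      rw [this, norm_smul, Real.norm_of_nonneg hθ.1]
      rw [Metric.mem_ball, dist_eq_norm] at hv
      nlinarith [norm_nonneg (v - u), hθ.2]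
    have h1 := (ContinuousMap.dist_apply_le_dist t).trans (Metric.mem_ball.1 (hball hw)).le
    rw [dist_eq_norm] at h1
    simpa [w] using h1
  have h2 := (convex_segment (u t) (v t)).norm_image_sub_le_of_norm_hasFDerivWithin_le'
    (fun y _ => (hf y).hasFDerivWithinAt) key (left_mem_segment ℝ _ _) (right_mem_segment ℝ _ _)
  refine le_trans ?_ (h2.trans ?_)
  · simp
  · gcongr
    exact (v - u).norm_coe_le_norm t

/-- Superposition by a `Cⁿ` function is `Cⁿ` on the space of continuous functions. -/
theorem contDiff_superposition (n : ℕ) : ∀ {F : Type} [NormedAddCommGroup F] [NormedSpace ℝ F]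
    (f : C(E, F)), ContDiff ℝ n f → ContDiff ℝ n (fun u : C(K, E) => f.comp u) := by
  induction n with
  | zero =>
    intro F _ _ f _
    exact contDiff_zero.2 f.continuous_postcomp
  | succ n ih =>
    intro F _ _ f hf
    have hf' := contDiff_succ_iff_hasFDerivAt.1 (by exact_mod_cast hf)
    obtain ⟨f', hf', hd⟩ := hf'
    push_cast
    -- The derivative is superposition by `f'` followed by the bounded map `pointwiseApply`. The
    -- induction hypothesis is used for `f'`, whose target is `E →L[ℝ] F`; hence the quantification
    -- over `F`.
    rw [contDiff_succ_iff_hasFDerivAt]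
    exact ⟨fun u => pointwiseApply K E F (ContinuousMap.comp ⟨f', hf'.continuous⟩ u),
      (ih ⟨f', hf'.continuous⟩ hf').continuousLinearMap_comp (pointwiseApply K E F), fun u => hasFDerivAt_superposition f ⟨f', hf'.continuous⟩ hd u⟩

theorem contDiff_infty_superposition {F : Type} [NormedAddCommGroup F] [NormedSpace ℝ F]
    (f : C(E, F)) (hf : ContDiff ℝ ∞ f) : ContDiff ℝ ∞ (fun u : C(K, E) => f.comp u) :=
  contDiff_infty.2 fun n => contDiff_superposition n f (contDiff_infty.1 hf n)

end Nemytskii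

section Primitive

variable {E : Type*} [NormedAddCommGroup E] [NormedSpace ℝ E]

/-- The primitive vanishing at `0` of a continuous function on the unit interval. -/
noncomputable def primitive (E : Type*) [NormedAddCommGroup E] [NormedSpace ℝ E] :
    C(Icc (0 : ℝ) 1, E) →L[ℝ] C(Icc (0 : ℝ) 1, E) :=
  LinearMap.mkContinuous
    { toFun := fun u => ⟨fun t => ∫ s in (0 : ℝ)..t, IccExtend zero_le_one u s, by
        have : Continuous (IccExtend (zero_le_one' ℝ) u) := u.continuous.Icc_extend'
        exact (intervalIntegral.continuous_primitive
          (fun a b => this.intervalIntegrable a b) 0).comp continuous_subtype_val⟩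
      map_add' := fun u v => by
        ext t
        have hu : Continuous (IccExtend (zero_le_one' ℝ) u) := u.continuous.Icc_extend'
        have hv : Continuous (IccExtend (zero_le_one' ℝ) v) := v.continuous.Icc_extend'
        exact intervalIntegral.integral_add (hu.intervalIntegrable _ _)
          (hv.intervalIntegrable _ _)
      map_smul' := fun c u => by
        ext t
        exact intervalIntegral.integral_smul c _ } 1 (by
    intro u
    rw [ContinuousMap.norm_le _ (by positivity), one_mul]
    intro t
    have := intervalIntegral.norm_integral_le_of_norm_le_const (a := (0 : ℝ)) (b := t)
      (f := IccExtend (zero_le_one' ℝ) u) (C := ‖u‖) (fun x _ => u.norm_coe_le_norm _)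
    refine this.trans ?_
    rw [sub_zero, abs_of_nonneg t.2.1]
    exact mul_le_of_le_one_right (norm_nonneg _) t.2.2)

theorem primitive_apply (u : C(Icc (0 : ℝ) 1, E)) (t : Icc (0 : ℝ) 1) :
    primitive E u t = ∫ s in (0 : ℝ)..t, IccExtend (zero_le_one' ℝ) u s := rfl

end Primitive

/-! ### Joint flow of commuting vector fields -/

section Flow

variable {E : Type} [NormedAddCommGroup E] [NormedSpace ℝ E] [CompleteSpace E]

/-- A product rule for primitives along a curve solving an integral equation. -/
theorem smul_comp_eq_primitive {F : Type} [NormedAddCommGroup F] [NormedSpace ℝ F]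
    [CompleteSpace F] (g : E → F) (g' : E → E →L[ℝ] F) (hg : ∀ x, HasFDerivAt g (g' x) x)
    (u w : C(Icc (0 : ℝ) 1, E)) (y : E) (hu : ∀ t, u t = y + primitive E w t)
    (k : C(Icc (0 : ℝ) 1, F)) (hk : ∀ s, k s = (s : ℝ) • g' (u s) (w s) + g (u s))
    (t : Icc (0 : ℝ) 1) : (t : ℝ) • g (u t) = primitive F k t := by
  have hwc : Continuous (IccExtend (zero_le_one' ℝ) w) := w.continuous.Icc_extend'
  have hkc : Continuous (IccExtend (zero_le_one' ℝ) k) := k.continuous.Icc_extend'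
  -- `v` extends `u` to the whole line, so that two-sided derivatives exist also at the endpoints of
  -- the interval.
  set v : ℝ → E := fun s => y + ∫ r in (0 : ℝ)..s, IccExtend (zero_le_one' ℝ) w r with hv
  have hvd : ∀ s, HasDerivAt v (IccExtend (zero_le_one' ℝ) w s) s := fun s =>
    (intervalIntegral.integral_hasDerivAt_right (hwc.intervalIntegrable _ _)
      hwc.stronglyMeasurable.stronglyMeasurableAtFilter hwc.continuousAt).const_add y
  have hvu : ∀ s : Icc (0 : ℝ) 1, v s = u s := fun s => by rw [hu, primitive_apply]
  rw [primitive_apply]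
  have hder : ∀ s ∈ uIcc (0 : ℝ) t,
      HasDerivAt (fun s : ℝ => s • g (v s)) (IccExtend (zero_le_one' ℝ) k s) s := by
    intro s hs
    rw [uIcc_of_le t.2.1] at hs
    have hs' : s ∈ Icc (0 : ℝ) 1 := ⟨hs.1, hs.2.trans t.2.2⟩
    have h1 := (hg (v s)).comp_hasDerivAt s (hvd s)
    have h2 := (hasDerivAt_id s).smul h1
    rw [IccExtend_of_mem _ _ hs', hk]
    rw [IccExtend_of_mem _ _ hs'] at h2
    have h4 := hvu ⟨s, hs'⟩
    simp only at h4
    simp only [Function.comp_apply, h4, one_smul, id] at h2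
    exact h2
  rw [intervalIntegral.integral_eq_sub_of_hasDerivAt hder (hkc.intervalIntegrable _ _), hvu]
  simp

/-- Solutions `u` of `u = κ y + B (S u) c`, for small `c`, as a smooth function of `(c, y)`. -/
theorem exists_smooth_solution {C E X Y : Type*} [NormedAddCommGroup C] [NormedSpace ℝ C]
    [CompleteSpace C] [NormedAddCommGroup E] [NormedSpace ℝ E] [CompleteSpace E]
    [NormedAddCommGroup X] [NormedSpace ℝ X] [CompleteSpace X]
    [NormedAddCommGroup Y] [NormedSpace ℝ Y] (S : X → Y) (hS : ContDiff ℝ ∞ S)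
    (B : Y →L[ℝ] C →L[ℝ] X) (κ : E →L[ℝ] X) (x₀ : E) {V : Set X} (hV : IsOpen V)
    (hx₀ : κ x₀ ∈ V) :
    ∃ (N : Set (C × E)) (U : C × E → X), IsOpen N ∧ (0, x₀) ∈ N ∧ ContDiffOn ℝ ∞ U N ∧
      (∀ p ∈ N, U p ∈ V ∧ U p = κ p.2 + B (S (U p)) p.1) ∧
      ∀ p ∈ N, ∀ c w, w = B (fderiv ℝ S (U p) w) p.1 + B (S (U p)) c →
        fderiv ℝ U p (c, 0) = w := by
  -- Solutions are the zeros of `F`. At `c = 0` the derivative of `F` in `u` is the identity, so the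
  -- map `H` that retains the parameters and appends `F` is locally invertible.
  let F : (C × E) × X → X := fun q => q.2 - κ q.1.2 - B (S q.2) q.1.1
  have hF : ContDiff ℝ ∞ F := by
    refine (contDiff_snd.sub (κ.contDiff.comp (contDiff_snd.comp contDiff_fst))).sub ?_
    have h1 : ContDiff ℝ ∞ fun q : (C × E) × X => S q.2 := hS.comp contDiff_snd
    have h2 : ContDiff ℝ ∞ fun q : (C × E) × X => q.1.1 := contDiff_fst.comp contDiff_fst
    exact (h1.continuousLinearMap_comp B).clm_apply h2
  let dF : (C × E) × X → (C × E) × X → X := fun q h =>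
    h.2 - κ h.1.2 - (B (fderiv ℝ S q.2 h.2) q.1.1 + B (S q.2) h.1.1)
  have hFd : ∀ q h, fderiv ℝ F q h = dF q h := by
    intro q h
    have h0 : HasFDerivAt (fun q : (C × E) × X => S q.2)
        (fderiv ℝ S q.2 ∘L ContinuousLinearMap.snd ℝ (C × E) X) q :=
      ((hS.differentiable (by simp) q.2).hasFDerivAt).comp q hasFDerivAt_snd
    have h1 : HasFDerivAt (fun q : (C × E) × X => B (S q.2))
        (B ∘L fderiv ℝ S q.2 ∘L ContinuousLinearMap.snd ℝ (C × E) X) q :=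
      B.hasFDerivAt.comp q h0
    have h2 := (ContinuousLinearMap.fst ℝ C E ∘L
      ContinuousLinearMap.fst ℝ (C × E) X).hasFDerivAt (x := q)
    have h3 := h1.clm_apply h2
    have h4 := (κ ∘L ContinuousLinearMap.snd ℝ C E ∘L
      ContinuousLinearMap.fst ℝ (C × E) X).hasFDerivAt (x := q)
    have h5 := (hasFDerivAt_snd.sub h4).sub h3
    have h6 : HasFDerivAt F _ q := h5
    rw [h6.fderiv]
    simp [dF, add_comm]
  let H : (C × E) × X → (C × E) × X := fun q => (q.1, F q)
  have hH : ContDiff ℝ ∞ H := contDiff_fst.prodMk hF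
  have hHd : ∀ q h, fderiv ℝ H q h = (h.1, dF q h) := by
    intro q h
    have h1 : HasFDerivAt H _ q :=
      hasFDerivAt_fst.prodMk ((hF.differentiable (by simp) q).hasFDerivAt)
    rw [h1.fderiv, ← hFd]
    rfl
  let q₀ : (C × E) × X := ((0, x₀), κ x₀)
  have hinv : (fderiv ℝ H q₀).IsInvertible := by
    -- The derivative of `H` at `q₀` is the shear `(h, k) ↦ (h, k - R h)`; its inverse is the shear
    -- by `+R`.
    let R : (C × E) →L[ℝ] X :=
      κ ∘L ContinuousLinearMap.snd ℝ C E + B (S (κ x₀)) ∘L ContinuousLinearMap.fst ℝ C E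
    refine ContinuousLinearMap.IsInvertible.of_inverse
      (g := (ContinuousLinearMap.fst ℝ (C × E) X).prod
        (ContinuousLinearMap.snd ℝ _ _ + R ∘L ContinuousLinearMap.fst ℝ _ _)) ?_ ?_
    · refine ContinuousLinearMap.ext fun h => ?_
      simp only [ContinuousLinearMap.comp_apply, hHd]
      refine Prod.ext rfl ?_
      simp [dF, q₀, R]
      abel
    · refine ContinuousLinearMap.ext fun h => ?_
      simp only [ContinuousLinearMap.comp_apply]
      simp only [ContinuousLinearMap.prod_apply, hHd, add_apply,
        ContinuousLinearMap.comp_apply]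
      refine Prod.ext rfl ?_
      simp [dF, q₀, R]
  obtain ⟨e, he₀, heO, heH, heinv, hesymm⟩ :=
    exists_smooth_local_inverse (hV.preimage continuous_snd) hH.contDiffOn
      (a := q₀) hx₀ hinv
  let U : C × E → X := fun p => (e.symm (p, 0)).2
  let N : Set (C × E) := (fun p => (p, (0 : X))) ⁻¹' e.target
  have hN : IsOpen N := e.open_target.preimage (by fun_prop)
  have hUp : ∀ p ∈ N, e.symm (p, 0) = (p, U p) ∧ F (p, U p) = 0 := by
    intro p hp
    have h1 : H (e.symm (p, 0)) = (p, 0) := by rw [← heH]; exact e.right_inv hp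
    have h2 : (e.symm (p, 0)).1 = p := congrArg Prod.fst h1
    have h3 : e.symm (p, 0) = (p, U p) := Prod.ext h2 rfl
    refine ⟨h3, ?_⟩
    have h4 := congrArg Prod.snd h1
    rw [h3] at h4
    exact h4
  have hUmem : ∀ p ∈ N, (p, U p) ∈ e.source := fun p hp => by
    rw [← (hUp p hp).1]; exact e.map_target hp
  have hUs : ContDiffOn ℝ ∞ U N := by
    refine contDiff_snd.comp_contDiffOn (hesymm.comp ?_ fun p hp => hp)
    exact (contDiff_id.prodMk contDiff_const).contDiffOn
  refine ⟨N, U, hN, ?_, hUs, fun p hp => ⟨show (p, U p).2 ∈ V from heO (hUmem p hp), ?_⟩, ?_⟩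
  · change ((0, x₀), (0 : X)) ∈ e.target
    have h1 : H q₀ = ((0, x₀), 0) := by simp [H, F, q₀]
    rw [← h1, ← heH]
    exact e.map_source he₀
  · have := (hUp p hp).2
    simp only [F, sub_sub, sub_eq_zero] at this
    exact this
  · intro p hp c w hw
    have hUd : HasFDerivAt U (fderiv ℝ U p) p :=
      ((hUs.contDiffAt (hN.mem_nhds hp)).differentiableAt (by simp)).hasFDerivAt
    have hu' : dF (p, U p) ((c, 0), fderiv ℝ U p (c, 0)) = 0 := by
      have h1 : HasFDerivAt (fun p => F (p, U p)) _ p :=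
        HasFDerivAt.comp (g := F) (f := fun p => (p, U p)) p
          ((hF.differentiable (by simp) (p, U p)).hasFDerivAt) ((hasFDerivAt_id p).prodMk hUd)
      have h2 : (fun p => F (p, U p)) =ᶠ[𝓝 p] fun _ => 0 := by
        filter_upwards [hN.mem_nhds hp] with p hp using (hUp p hp).2
      have h3 := (h1.congr_of_eventuallyEq h2.symm).unique (hasFDerivAt_const 0 p)
      have h4 := congrArg (fun T => T ((c, 0) : C × E)) h3
      rw [← hFd]
      exact h4
    -- Both `w` and the true derivative solve the linearized equation, and the injectivity of the
    -- derivative of `H` at this point identifies them.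
    have hw' : dF (p, U p) ((c, 0), w) = 0 := by
      simp only [dF, map_zero, sub_zero, sub_eq_zero]
      exact hw
    obtain ⟨g, hg⟩ := heinv _ (hUmem p hp)
    have h1 : fderiv ℝ H (p, U p) ((c, 0), fderiv ℝ U p (c, 0))
        = fderiv ℝ H (p, U p) ((c, 0), w) := by
      rw [hHd, hHd]
      exact Prod.ext rfl (hu'.trans hw'.symm)
    rw [← hg] at h1
    exact congrArg Prod.snd (g.injective h1)

/-- Simultaneous flow of a commuting family of vector fields `G · c`. -/
theorem exists_commuting_flow {C : Type} [NormedAddCommGroup C] [NormedSpace ℝ C]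
    [CompleteSpace C] (G : E → C →L[ℝ] E) (hG : ContDiff ℝ ∞ G) (x₀ : E) {V : Set E}
    (hV : IsOpen V) (hx₀ : x₀ ∈ V)
    (hcomm : ∀ x ∈ V, ∀ c c', fderiv ℝ G x (G x c) c' = fderiv ℝ G x (G x c') c) :
    ∃ (N : Set (C × E)) (Φ : C × E → E), IsOpen N ∧ (0, x₀) ∈ N ∧ ContDiffOn ℝ ∞ Φ N ∧
      (∀ y, (0, y) ∈ N → Φ (0, y) = y) ∧ (∀ p ∈ N, Φ p ∈ V) ∧
      ∀ p ∈ N, ∀ c, fderiv ℝ Φ p (c, 0) = G (Φ p) c := by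
  have hGd : ∀ x, HasFDerivAt G (fderiv ℝ G x) x := fun x =>
    (hG.differentiable (by simp) x).hasFDerivAt
  let Gc : C(E, C →L[ℝ] E) := ⟨G, hG.continuous⟩
  let DG : C(E, E →L[ℝ] C →L[ℝ] E) := ⟨fderiv ℝ G, hG.continuous_fderiv (by simp)⟩
  have hSd : ∀ u : C(Icc (0 : ℝ) 1, E), fderiv ℝ (fun u => Gc.comp u) u = _ := fun u =>
    (hasFDerivAt_superposition Gc DG hGd u).fderiv
  -- With this `B` the equation reads `u t = y + ∫₀ᵗ G (u s) c ds`: the integral curve of the field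
  -- `G · c` starting at `y`. Its value at time `1` is the joint flow.
  let B : C(Icc (0 : ℝ) 1, C →L[ℝ] E) →L[ℝ] C →L[ℝ] C(Icc (0 : ℝ) 1, E) :=
    (ContinuousLinearMap.compL ℝ C _ _ (primitive E)) ∘L constApply (Icc (0 : ℝ) 1) C E
  let κ : E →L[ℝ] C(Icc (0 : ℝ) 1, E) := ContinuousLinearMap.const ℝ (Icc (0 : ℝ) 1)
  obtain ⟨N, U, hN, h0, hU, hUp, hUd⟩ := exists_smooth_solution
    (fun u : C(Icc (0 : ℝ) 1, E) => Gc.comp u) (contDiff_infty_superposition Gc hG) B κ x₀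
    (V := {u | MapsTo u univ V}) (ContinuousMap.isOpen_setOfPred_mapsTo isCompact_univ hV)
    (fun t _ => hx₀)
  let ev : C(Icc (0 : ℝ) 1, E) →L[ℝ] E := ContinuousMap.evalCLM ℝ 1
  refine ⟨N, fun p => ev (U p), hN, h0, hU.continuousLinearMap_comp ev, ?_, ?_, ?_⟩
  · intro y hy
    have h1 := (hUp _ hy).2
    have h2 : U (0, y) = κ y := by simpa using h1
    simp only [h2]
    rfl
  · exact fun p hp => (hUp p hp).1 (mem_univ _)
  · intro p hp c'
    have hUd' : HasFDerivAt U (fderiv ℝ U p) p :=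
      ((hU.contDiffAt (hN.mem_nhds hp)).differentiableAt (by simp)).hasFDerivAt
    -- The expected derivative of the curve in the direction `c'`. Commutation replaces `DG (G c')
    -- c` by `DG (G c) c'` in the linearized equation, whose integrand then becomes the derivative
    -- of `s • G (u s) c'` along the curve.
    let w : C(Icc (0 : ℝ) 1, E) := ⟨fun t => (t : ℝ) • G (U p t) c', by
      have := hG.continuous
      fun_prop⟩
    have hw : fderiv ℝ U p (c', 0) = w := by
      apply hUd p hp
      rw [hSd]
      ext t
      refine smul_comp_eq_primitive (fun x => G x c')
        (fun x => (ContinuousLinearMap.apply ℝ E c') ∘L fderiv ℝ G x)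
        (fun x => ((ContinuousLinearMap.apply ℝ E c').hasFDerivAt).comp x (hGd x))
        (U p) (constApply _ C E (Gc.comp (U p)) p.1) p.2
        (fun t => by nth_rw 1 [(hUp p hp).2]; rfl)
        (constApply _ C E (pointwiseApply _ E (C →L[ℝ] E) (DG.comp (U p)) w) p.1
          + constApply _ C E (Gc.comp (U p)) c') ?_ t |>.trans ?_
      · intro s
        have h2 := hcomm (U p s) ((hUp p hp).1 (mem_univ s)) p.1 c'
        change fderiv ℝ G (U p s) ((s : ℝ) • G (U p s) c') p.1 + G (U p s) c'
          = (s : ℝ) • fderiv ℝ G (U p s) (G (U p s) p.1) c' + G (U p s) c'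
        rw [h2]
        simp
      · rw [map_add]
        rfl
    have h1 : HasFDerivAt (fun p => ev (U p)) _ p := ev.hasFDerivAt.comp p hUd'
    rw [h1.fderiv]
    change fderiv ℝ U p (c', 0) 1 = _
    rw [hw]
    change ((1 : Icc (0 : ℝ) 1) : ℝ) • G (U p 1) c' = G (U p 1) c'
    simp

end Flow

/-! ### The Frobenius theorem -/

section Frobenius

variable {E : Type} [NormedAddCommGroup E] [NormedSpace ℝ E] [FiniteDimensional ℝ E]

/-- A bump function makes a local field global without changing it near `x₀`; superposition requires
a field defined and smooth on the whole space. -/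
theorem exists_contDiff_eqOn {F : Type*} [NormedAddCommGroup F] [NormedSpace ℝ F] {G : E → F}
    {Ω : Set E} (hΩ : IsOpen Ω) (hG : ContDiffOn ℝ ∞ G Ω) {x₀ : E} (hx₀ : x₀ ∈ Ω) :
    ∃ (G' : E → F) (V : Set E), ContDiff ℝ ∞ G' ∧ IsOpen V ∧ x₀ ∈ V ∧ V ⊆ Ω ∧ EqOn G' G V := by
  obtain ⟨ε, hε, hεΩ⟩ := Metric.isOpen_iff.1 hΩ x₀ hx₀
  let b : ContDiffBump x₀ := ⟨ε / 4, ε / 2, by positivity, by linarith⟩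
  refine ⟨fun x => b x • G x, Metric.ball x₀ (ε / 4), ?_, Metric.isOpen_ball,
    Metric.mem_ball_self (by positivity), (Metric.ball_subset_ball (by linarith)).trans hεΩ, ?_⟩
  · rw [contDiff_iff_contDiffAt]
    intro x
    by_cases hx : x ∈ Ω
    · exact b.contDiffAt.smul (hG.contDiffAt (hΩ.mem_nhds hx))
    · have h1 : x ∈ (Metric.closedBall x₀ (ε / 2))ᶜ := fun h => hx (hεΩ
        (Metric.closedBall_subset_ball (by linarith) h))
      have h2 : (fun x => b x • G x) =ᶠ[𝓝 x] fun _ => 0 := by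
        filter_upwards [Metric.isClosed_closedBall.isOpen_compl.mem_nhds h1] with y hy
        rw [b.zero_of_le_dist, zero_smul]
        simp only [mem_compl_iff, Metric.mem_closedBall, not_le] at hy
        exact hy.le
      exact contDiffAt_const.congr_of_eventuallyEq h2
  · intro x hx
    simp only
    rw [b.one_of_mem_closedBall (Metric.ball_subset_closedBall hx), one_smul]

theorem isInvertible_of_injective {F : Type*} [NormedAddCommGroup F] [NormedSpace ℝ F]
    [FiniteDimensional ℝ F] (f : E →L[ℝ] F) (hf : Function.Injective f)
    (h : Module.finrank ℝ E = Module.finrank ℝ F) : f.IsInvertible :=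
  ⟨(LinearEquiv.ofInjectiveOfFinrankEq (f : E →ₗ[ℝ] F) hf h).toContinuousLinearEquiv,
    by ext x; rfl⟩

/-- The Frobenius theorem for the distribution spanned by a commuting family of fields. -/
theorem exists_first_integrals_of_commuting {C : Type} [NormedAddCommGroup C] [NormedSpace ℝ C]
    [FiniteDimensional ℝ C] {Ω : Set E} (hΩ : IsOpen Ω) (G : E → C →L[ℝ] E)
    (hG : ContDiffOn ℝ ∞ G Ω) {x₀ : E} (hx₀ : x₀ ∈ Ω)
    (hcomm : ∀ x ∈ Ω, ∀ c c', fderiv ℝ G x (G x c) c' = fderiv ℝ G x (G x c') c)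
    (π : E →L[ℝ] C) (hπ : ∀ c, π (G x₀ c) = c) {r : ℕ}
    (hr : Module.finrank ℝ C + r = Module.finrank ℝ E) :
    ∃ (V : Set E) (f : E → Fin r → ℝ), IsOpen V ∧ x₀ ∈ V ∧ V ⊆ Ω ∧ ContDiffOn ℝ ∞ f V ∧
      ∀ x ∈ V, ∀ v, fderiv ℝ f x v = 0 ↔ ∃ c, G x c = v := by
  have : CompleteSpace E := FiniteDimensional.complete ℝ E
  have : CompleteSpace C := FiniteDimensional.complete ℝ C
  obtain ⟨G', V, hG', hV, hxV, hVΩ, hGV⟩ := exists_contDiff_eqOn hΩ hG hx₀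
  obtain ⟨N, Φ, hN, h0, hΦ, hΦ0, hΦV, hΦd⟩ := exists_commuting_flow G' hG' x₀ hV hxV (by
    intro x hx c c'
    rw [hGV hx, (hGV.eventuallyEq_of_mem (hV.mem_nhds hx)).fderiv_eq]
    exact hcomm x (hVΩ hx) c c')
  have hsurj : Function.Surjective π := fun c => ⟨_, hπ c⟩
  have hker : Module.finrank ℝ (Fin r → ℝ) = Module.finrank ℝ (LinearMap.ker (π : E →ₗ[ℝ] C)) := by
    have h1 := LinearMap.finrank_range_add_finrank_ker (π : E →ₗ[ℝ] C)
    rw [LinearMap.range_eq_top.2 hsurj, finrank_top] at h1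
    rw [Module.finrank_fin_fun]
    omega
  -- `ker π` is a complement of the range of `G x₀`. It serves as a transversal through `x₀`,
  -- parametrized by `ε`.
  let ε : (Fin r → ℝ) →L[ℝ] E := (LinearMap.ker (π : E →ₗ[ℝ] C)).subtypeL ∘L
    (ContinuousLinearEquiv.ofFinrankEq hker : (Fin r → ℝ) →L[ℝ] _)
  have hεπ : ∀ d, π (ε d) = 0 := fun d => (ContinuousLinearEquiv.ofFinrankEq hker d).2
  have hεinj : Function.Injective ε :=
    Subtype.val_injective.comp (ContinuousLinearEquiv.ofFinrankEq hker).injective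
  let τ : C × (Fin r → ℝ) → C × E := fun p => (p.1, x₀ + ε p.2)
  have hτ : ContDiff ℝ ∞ τ :=
    contDiff_fst.prodMk (contDiff_const.add (ε.contDiff.comp contDiff_snd))
  have hτd : ∀ p, HasFDerivAt τ ((ContinuousLinearMap.fst ℝ C (Fin r → ℝ)).prod
      (ε ∘L ContinuousLinearMap.snd ℝ C (Fin r → ℝ))) p := fun p =>
    hasFDerivAt_fst.prodMk ((ε.hasFDerivAt.comp p hasFDerivAt_snd).const_add x₀)
  have hN' : IsOpen (τ ⁻¹' N) := hN.preimage hτ.continuous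
  -- Flow box: start on the transversal at `d` and flow by `c`. The slices with `d` constant are
  -- integral manifolds, so the `d`-component of the inverse of `Ψ` gives the first integrals.
  let Ψ : C × (Fin r → ℝ) → E := Φ ∘ τ
  have hΨ : ContDiffOn ℝ ∞ Ψ (τ ⁻¹' N) := hΦ.comp hτ.contDiffOn fun _ h => h
  have hΨd : ∀ p ∈ τ ⁻¹' N, ∀ h, fderiv ℝ Ψ p h = fderiv ℝ Φ (τ p) (h.1, ε h.2) := by
    intro p hp h
    have h1 := (((hΦ.contDiffAt (hN.mem_nhds hp)).differentiableAt
      (by simp)).hasFDerivAt).comp p (hτd p)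
    rw [h1.fderiv]
    rfl
  have hΨG : ∀ p ∈ τ ⁻¹' N, ∀ c, fderiv ℝ Ψ p (c, 0) = G (Ψ p) c := by
    intro p hp c
    rw [hΨd p hp, map_zero, hΦd _ hp, hGV (hΦV _ hp)]
    rfl
  have hp₀ : (0 : C × (Fin r → ℝ)) ∈ τ ⁻¹' N := by
    change (0, x₀ + ε 0) ∈ N
    simpa using h0
  have hΨ0 : Ψ 0 = x₀ := by
    change Φ (0, x₀ + ε 0) = x₀
    rw [map_zero, add_zero]
    exact hΦ0 _ h0
  have hinv : (fderiv ℝ Ψ 0).IsInvertible := by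
    have hd : ∀ d, fderiv ℝ Ψ 0 (0, d) = ε d := by
      intro d
      rw [hΨd 0 hp₀]
      have h1 : τ 0 = (0, x₀) := by simp [τ]
      rw [h1]
      have h2 : HasFDerivAt (fun y => Φ (0, y)) _ x₀ :=
        HasFDerivAt.comp (g := Φ) (f := fun y => ((0 : C), y)) x₀
          (((hΦ.contDiffAt (hN.mem_nhds h0)).differentiableAt (by simp)).hasFDerivAt)
          ((hasFDerivAt_const (0 : C) x₀).prodMk (hasFDerivAt_id x₀))
      have h3 : (fun y => Φ (0, y)) =ᶠ[𝓝 x₀] id := by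
        have : (fun y => ((0 : C), y)) ⁻¹' N ∈ 𝓝 x₀ :=
          (hN.preimage (by fun_prop)).mem_nhds h0
        filter_upwards [this] with y hy using hΦ0 y hy
      have h4 := (h2.congr_of_eventuallyEq h3.symm).unique (hasFDerivAt_id x₀)
      exact congrArg (fun T => T (ε d)) h4
    refine isInvertible_of_injective _ ?_ ?_
    · rw [injective_iff_map_eq_zero]
      rintro ⟨c, d⟩ h
      have h1 : ((c, d) : C × (Fin r → ℝ)) = (c, 0) + (0, d) := by simp
      rw [h1, map_add, hd, hΨG 0 hp₀, hΨ0] at h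
      have h2 := congrArg π h
      rw [map_add, hπ, hεπ, add_zero, map_zero] at h2
      rw [h2, map_zero, zero_add] at h
      have h3 : d = 0 := hεinj (h.trans (map_zero ε).symm)
      rw [h2, h3]
      rfl
    · rw [Module.finrank_prod, Module.finrank_fin_fun, hr]
  obtain ⟨e, he₀, heN, heΨ, heinv, hesymm⟩ := exists_smooth_local_inverse hN' hΨ hp₀ hinv
  have heΨ' : (e : C × (Fin r → ℝ) → E) = Ψ := funext heΨ
  refine ⟨e.target, fun x => (e.symm x).2, e.open_target, ?_, ?_, ?_, ?_⟩
  · rw [← hΨ0, ← heΨ]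
    exact e.map_source he₀
  · intro x hx
    have h1 := hΦV _ (heN (e.map_target hx))
    have h2 : Φ (τ (e.symm x)) = x := (heΨ _).symm.trans (e.right_inv hx)
    rw [h2] at h1
    exact hVΩ h1
  · exact contDiff_snd.comp_contDiffOn hesymm
  · intro x hx v
    set p := e.symm x
    have hp : p ∈ e.source := e.map_target hx
    have hpx : Ψ p = x := (heΨ _).symm.trans (e.right_inv hx)
    obtain ⟨g, hg⟩ := heinv p hp
    have hgd : HasFDerivAt Ψ (g : C × (Fin r → ℝ) →L[ℝ] E) p := by
      rw [hg]
      exact ((hΨ.contDiffAt (hN'.mem_nhds (heN hp))).differentiableAt (by simp)).hasFDerivAt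
    have hsd : HasFDerivAt e.symm (g.symm : E →L[ℝ] C × (Fin r → ℝ)) x :=
      e.hasFDerivAt_symm hx (heΨ' ▸ hgd)
    have hfd : HasFDerivAt (fun x => (e.symm x).2) _ x :=
      HasFDerivAt.comp (g := Prod.snd) x hasFDerivAt_snd hsd
    rw [hfd.fderiv]
    change (g.symm v).2 = 0 ↔ _
    have hgG : ∀ c, g (c, 0) = G x c := fun c => by
      rw [← hpx, ← hΨG p (heN hp), ← hg]
      rfl
    constructor
    · intro h
      refine ⟨(g.symm v).1, ?_⟩
      rw [← hgG, ← h]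
      exact g.apply_symm_apply v
    · rintro ⟨c, rfl⟩
      rw [← hgG, g.symm_apply_apply]

/-- The Frobenius theorem for the range of a smooth field of operators of constant rank. -/
theorem exists_first_integrals {Ω : Set E} (hΩ : IsOpen Ω) (A : E → E →L[ℝ] E)
    (hA : ContDiffOn ℝ ∞ A Ω) {x₀ : E} (hx₀ : x₀ ∈ Ω) {r : ℕ}
    (hr : ∀ x ∈ Ω, Module.finrank ℝ (LinearMap.range (A x : E →ₗ[ℝ] E)) + r
      = Module.finrank ℝ E)
    (hinv : ∀ Ω' ⊆ Ω, IsOpen Ω' → ∀ X Y : E → E, ContDiffOn ℝ ∞ X Ω' → ContDiffOn ℝ ∞ Y Ω' →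
      (∀ x ∈ Ω', ∃ u, A x u = X x) → (∀ x ∈ Ω', ∃ u, A x u = Y x) →
      ∀ x ∈ Ω', ∃ u, A x u = VectorField.lieBracket ℝ X Y x) :
    ∃ (V : Set E) (f : E → Fin r → ℝ), IsOpen V ∧ x₀ ∈ V ∧ V ⊆ Ω ∧ ContDiffOn ℝ ∞ f V ∧
      ∀ x ∈ V, ∀ v, fderiv ℝ f x v = 0 ↔ ∃ u, A x u = v := by
  have : CompleteSpace E := FiniteDimensional.complete ℝ E
  -- The distribution near `x₀` is written as a graph over its value `C` at `x₀`, using a projection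
  -- `π` onto `C`.
  let C := LinearMap.range (A x₀ : E →ₗ[ℝ] E)
  obtain ⟨π, hπ⟩ := Submodule.ClosedComplemented.of_finiteDimensional C
  obtain ⟨s₀, hs₀⟩ := LinearMap.exists_rightInverse_of_surjective
    ((A x₀ : E →ₗ[ℝ] E).rangeRestrict) (LinearMap.range_rangeRestrict _)
  let s : C →L[ℝ] E := LinearMap.toContinuousLinearMap s₀
  have hs : ∀ c : C, A x₀ (s c) = c := fun c =>
    congrArg Subtype.val (LinearMap.congr_fun hs₀ c)
  let M : E → C →L[ℝ] C := fun x => π ∘L A x ∘L s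
  have hM : ContDiffOn ℝ ∞ M Ω := contDiffOn_const.clm_comp (hA.clm_comp contDiffOn_const)
  have hM₀ : M x₀ = ContinuousLinearMap.id ℝ C := by
    refine ContinuousLinearMap.ext fun c => ?_
    change π (A x₀ (s c)) = c
    rw [hs, hπ]
  let Ω₁ := Ω ∩ M ⁻¹' range ((↑) : (C ≃L[ℝ] C) → C →L[ℝ] C)
  have hΩ₁ : IsOpen Ω₁ := hM.continuousOn.isOpen_inter_preimage hΩ ContinuousLinearEquiv.isOpen
  have hx₁ : x₀ ∈ Ω₁ := ⟨hx₀, ContinuousLinearEquiv.refl ℝ C, hM₀.symm⟩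
  -- Normalized so that `π ∘ G x` is the identity. This normalization is what makes the fields `G ·
  -- c` commute.
  let G : E → C →L[ℝ] E := fun x => A x ∘L s ∘L (M x).inverse
  have hG : ContDiffOn ℝ ∞ G Ω₁ := by
    refine (hA.mono inter_subset_left).clm_comp (contDiffOn_const.clm_comp ?_)
    rintro x ⟨hx, g, hg⟩
    have h1 : ContDiffAt ℝ ∞ ContinuousLinearMap.inverse (M x) := hg ▸ contDiffAt_map_inverse g
    exact (h1.comp x (hM.contDiffAt (hΩ.mem_nhds hx))).contDiffWithinAt
  have hπG : ∀ x ∈ Ω₁, ∀ c, π (G x c) = c := by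
    rintro x ⟨_, g, hg⟩ c
    change M x ((M x).inverse c) = c
    rw [← hg, ContinuousLinearMap.inverse_equiv]
    exact g.apply_symm_apply c
  have hrange : ∀ x ∈ Ω₁, ∀ v, (∃ c, G x c = v) ↔ ∃ u, A x u = v := by
    intro x hx v
    have h1 : LinearMap.range (G x : C →ₗ[ℝ] E) ≤ LinearMap.range (A x : E →ₗ[ℝ] E) := by
      rintro _ ⟨c, rfl⟩
      exact ⟨s ((M x).inverse c), rfl⟩
    have hGinj : Function.Injective (G x : C →ₗ[ℝ] E) :=
      Function.LeftInverse.injective (g := π) (hπG x hx)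
    have h2 := Submodule.eq_of_le_of_finrank_eq h1 (by
      rw [LinearMap.finrank_range_of_inj hGinj]
      have := hr x hx.1
      have := hr x₀ hx₀
      change Module.finrank ℝ C + r = _ at this
      omega)
    have h3 : v ∈ LinearMap.range (G x : C →ₗ[ℝ] E) ↔ v ∈ LinearMap.range (A x : E →ₗ[ℝ] E) := by
      rw [h2]
    simpa using h3
  have hGd : ∀ x ∈ Ω₁, HasFDerivAt G (fderiv ℝ G x) x := fun x hx =>
    ((hG.contDiffAt (hΩ₁.mem_nhds hx)).differentiableAt (by simp)).hasFDerivAt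
  have hcomm : ∀ x ∈ Ω₁, ∀ c c', fderiv ℝ G x (G x c) c' = fderiv ℝ G x (G x c') c := by
    intro x hx c c'
    have hXd : ∀ c, HasFDerivAt (fun x => G x c)
        ((ContinuousLinearMap.apply ℝ E c) ∘L fderiv ℝ G x) x := fun c =>
      (ContinuousLinearMap.apply ℝ E c).hasFDerivAt.comp x (hGd x hx)
    -- `π (G x c)` is constant in `x`, so `π` kills the bracket of two fields `G · c`, `G · c'`. By
    -- involutivity the bracket has the form `G x b`; applying `π` gives `b = 0`.
    have hπd : ∀ c v, π (fderiv ℝ G x v c) = 0 := by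
      intro c v
      have h1 : HasFDerivAt (fun x => π (G x c)) _ x := π.hasFDerivAt.comp x (hXd c)
      have h2 : (fun x => π (G x c)) =ᶠ[𝓝 x] fun _ => c := by
        filter_upwards [hΩ₁.mem_nhds hx] with y hy using hπG y hy c
      have h3 := (h1.congr_of_eventuallyEq h2.symm).unique (hasFDerivAt_const c x)
      exact congrArg (fun T => T v) h3
    have hsm : ∀ c, ContDiffOn ℝ ∞ (fun x => G x c) Ω₁ := fun c => hG.clm_apply contDiffOn_const
    have h1 := hinv Ω₁ inter_subset_left hΩ₁ (fun x => G x c) (fun x => G x c') (hsm c) (hsm c')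
      (fun x hx => (hrange x hx _).1 ⟨c, rfl⟩) (fun x hx => (hrange x hx _).1 ⟨c', rfl⟩) x hx
    obtain ⟨b, hb⟩ := (hrange x hx _).2 h1
    rw [VectorField.lieBracket, (hXd c).fderiv, (hXd c').fderiv] at hb
    change G x b = fderiv ℝ G x (G x c) c' - fderiv ℝ G x (G x c') c at hb
    have h2 : b = 0 := by
      rw [← hπG x hx b, hb, map_sub, hπd, hπd, sub_zero]
    rw [h2, map_zero] at hb
    exact (sub_eq_zero.1 hb.symm)
  obtain ⟨V, f, hV, hxV, hVΩ, hf, hfG⟩ := exists_first_integrals_of_commuting hΩ₁ G hG hx₁ hcomm π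
    (hπG x₀ hx₁) (hr x₀ hx₀)
  exact ⟨V, f, hV, hxV, hVΩ.trans inter_subset_left, hf, fun x hx v =>
    (hfG x hx v).trans (hrange x (hVΩ hx) v)⟩

end Frobenius

/-! ### Primary decomposition through polynomials in the operator -/

section Spectral

open Polynomial

/-- The polynomial `(X - lᵢ)ⁿ`. -/
noncomputable def eigenPoly {s : ℕ} (n : ℕ) (l : Fin s → ℝ) (i : Fin s) : ℝ[X] := (X - C (l i)) ^ n

/-- The polynomial `∏_{j ≠ i} (X - lⱼ)ⁿ`. -/
noncomputable def cofactorPoly {s : ℕ} (n : ℕ) (l : Fin s → ℝ) (i : Fin s) : ℝ[X] :=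
  ∏ j ∈ Finset.univ.erase i, eigenPoly n l j

theorem cofactorPoly_mul_eigenPoly {s : ℕ} (n : ℕ) (l : Fin s → ℝ) (i : Fin s) :
    cofactorPoly n l i * eigenPoly n l i = ∏ j, eigenPoly n l j :=
  Finset.prod_erase_mul _ _ (Finset.mem_univ i)

theorem isCoprime_eigenPoly {s : ℕ} (n : ℕ) {l : Fin s → ℝ} (hl : Function.Injective l) :
    Pairwise (Function.onFun IsCoprime (eigenPoly n l)) := fun _ _ hij =>
  (pairwise_coprime_X_sub_C hl hij).pow

theorem isCoprime_eigenPoly_cofactorPoly {s : ℕ} (n : ℕ) {l : Fin s → ℝ}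
    (hl : Function.Injective l) (i : Fin s) : IsCoprime (eigenPoly n l i) (cofactorPoly n l i) :=
  IsCoprime.prod_right fun _ hj => isCoprime_eigenPoly n hl (Finset.ne_of_mem_erase hj).symm

theorem eigenPoly_dvd_cofactorPoly {s : ℕ} (n : ℕ) (l : Fin s → ℝ) {i j : Fin s} (hij : i ≠ j) :
    eigenPoly n l i ∣ cofactorPoly n l j :=
  Finset.dvd_prod_of_mem _ (Finset.mem_erase.2 ⟨hij, Finset.mem_univ i⟩)

variable {E : Type} [NormedAddCommGroup E] [NormedSpace ℝ E]

theorem aeval_toLinearMap (T : E →L[ℝ] E) (p : ℝ[X]) :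
    ((aeval T p : E →L[ℝ] E) : E →ₗ[ℝ] E) = aeval (T : Module.End ℝ E) p :=
  (aeval_algHom_apply ({ ContinuousLinearMap.toLinearMapRingHom with
    commutes' := fun _ => rfl } : (E →L[ℝ] E) →ₐ[ℝ] Module.End ℝ E) T p).symm

/-- Kernels of powers stabilize by exponent `finrank`, so one exponent serves at all points and the
eigenspace is the kernel of an operator smooth in the point. -/
theorem mem_maxGenEigenspace_iff [FiniteDimensional ℝ E] {s : ℕ} (l : Fin s → ℝ) (T : E →L[ℝ] E)
    (i : Fin s) (v : E) : v ∈ Module.End.maxGenEigenspace (T : Module.End ℝ E) (l i) ↔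
      aeval T (eigenPoly (Module.finrank ℝ E) l i) v = 0 := by
  rw [Module.End.maxGenEigenspace_eq_genEigenspace_finrank, Module.End.mem_genEigenspace_nat,
    LinearMap.mem_ker]
  have h : aeval T (eigenPoly (Module.finrank ℝ E) l i) v
      = aeval (T : Module.End ℝ E) (eigenPoly (Module.finrank ℝ E) l i) v := by
    rw [← aeval_toLinearMap]; rfl
  rw [h, eigenPoly, map_pow, map_sub, aeval_X, aeval_C, Algebra.algebraMap_eq_smul_one]

/-- The minimal polynomial splits, its roots are among the `l i`, and their multiplicities are at
most the dimension, so it divides the product. -/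
theorem aeval_prod_eigenPoly_eq_zero [FiniteDimensional ℝ E] {s : ℕ} {l : Fin s → ℝ}
    {T : E →L[ℝ] E} (hs : (minpoly ℝ (T : Module.End ℝ E)).Splits)
    (hl : ∀ μ, Module.End.HasEigenvalue (T : Module.End ℝ E) μ → ∃ i, l i = μ) :
    aeval T (∏ i, eigenPoly (Module.finrank ℝ E) l i) = 0 := by
  set m := minpoly ℝ (T : Module.End ℝ E)
  have hm0 : m ≠ 0 := minpoly.ne_zero (Algebra.IsIntegral.isIntegral _)
  have hP0 : (∏ i, eigenPoly (Module.finrank ℝ E) l i) ≠ 0 :=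
    Finset.prod_ne_zero_iff.2 fun i _ => pow_ne_zero _ (X_sub_C_ne_zero _)
  have hdvd : m ∣ ∏ i, eigenPoly (Module.finrank ℝ E) l i := by
    refine hs.dvd_of_roots_le_roots hm0 ?_
    rw [Multiset.le_iff_count]
    intro μ
    rw [count_roots, count_roots]
    by_cases hμ : m.IsRoot μ
    · obtain ⟨i, rfl⟩ := hl μ (Module.End.hasEigenvalue_of_isRoot hμ)
      have h1 : m.rootMultiplicity (l i) ≤ Module.finrank ℝ E := by
        rw [← count_roots]
        refine ((Multiset.count_le_card _ _).trans (card_roots' m)).trans ?_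
        rw [← LinearMap.charpoly_natDegree (T : Module.End ℝ E)]
        exact natDegree_le_of_dvd (LinearMap.minpoly_dvd_charpoly _)
          (LinearMap.charpoly_monic _).ne_zero
      refine h1.trans ?_
      rw [le_rootMultiplicity_iff hP0]
      exact Finset.dvd_prod_of_mem _ (Finset.mem_univ i)
    · rw [rootMultiplicity_eq_zero hμ]
      exact Nat.zero_le _
  have h1 : aeval (T : Module.End ℝ E) (∏ i, eigenPoly (Module.finrank ℝ E) l i) = 0 := by
    obtain ⟨q, hq⟩ := hdvd
    rw [hq, map_mul, minpoly.aeval, zero_mul]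
  rw [← aeval_toLinearMap] at h1
  exact ContinuousLinearMap.coe_injective h1

section Decomposition

variable {s n : ℕ} {l : Fin s → ℝ} {T : E →L[ℝ] E}

theorem aeval_comm_apply (T : E →L[ℝ] E) (p q : ℝ[X]) (v : E) :
    aeval T p (aeval T q v) = aeval T q (aeval T p v) := by
  rw [← mul_apply_eq_comp, ← mul_apply_eq_comp, ← map_mul, ← map_mul,
    mul_comm]

theorem cofactor_eigen_apply (hT : aeval T (∏ i, eigenPoly n l i) = 0) (i : Fin s) (v : E) :
    aeval T (cofactorPoly n l i) (aeval T (eigenPoly n l i) v) = 0 := by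
  rw [← mul_apply_eq_comp, ← map_mul, cofactorPoly_mul_eigenPoly, hT]
  rfl

theorem exists_bezout (n : ℕ) (T : E →L[ℝ] E) (hl : Function.Injective l) (i : Fin s) :
    ∃ p q : ℝ[X], ∀ v, aeval T p (aeval T (eigenPoly n l i) v)
      + aeval T q (aeval T (cofactorPoly n l i) v) = v := by
  obtain ⟨p, q, h⟩ := isCoprime_eigenPoly_cofactorPoly n hl i
  refine ⟨p, q, fun v => ?_⟩
  have h1 := congrArg (fun r => aeval T r v) h
  simpa using h1

/-- Bezout for the coprime pair `eigenPoly`, `cofactorPoly`. Viewing the complement both as a range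
(sections are easy to write) and as a kernel (membership is an equation) is used throughout. -/
theorem range_eigen_iff (hl : Function.Injective l) (hT : aeval T (∏ i, eigenPoly n l i) = 0)
    (i : Fin s) (v : E) :
    (∃ u, aeval T (eigenPoly n l i) u = v) ↔ aeval T (cofactorPoly n l i) v = 0 := by
  constructor
  · rintro ⟨u, rfl⟩
    exact cofactor_eigen_apply hT i u
  · intro h
    obtain ⟨p, q, hpq⟩ := exists_bezout n T hl i
    have h1 := hpq v
    rw [h, map_zero, add_zero, aeval_comm_apply] at h1
    exact ⟨_, h1⟩

/-- A vector lies in the `i`-th generalized eigenspace iff it lies in the complements of all the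
others. -/
theorem eigen_eq_zero_iff (hl : Function.Injective l)
    (hT : aeval T (∏ i, eigenPoly n l i) = 0) (i : Fin s) (v : E) :
    aeval T (eigenPoly n l i) v = 0 ↔ ∀ j ≠ i, aeval T (cofactorPoly n l j) v = 0 := by
  constructor
  · intro h j hj
    obtain ⟨q, hq⟩ := eigenPoly_dvd_cofactorPoly n l hj.symm
    rw [hq, mul_comm, map_mul, mul_apply_eq_comp, h, map_zero]
  · intro h
    have : Nonempty (Fin s) := ⟨i⟩
    obtain ⟨μ, hμ⟩ := exists_sum_eq_one_iff_pairwise_coprime'.2 (isCoprime_eigenPoly n hl)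
    have h1 : v = ∑ j, aeval T (μ j) (aeval T (cofactorPoly n l j) v) := by
      have h2 := congrArg (fun r => aeval T r v) hμ
      simp only [map_sum, map_mul, map_one, one_apply_eq_self] at h2
      nth_rw 1 [← h2]
      rw [sum_apply]
      refine Finset.sum_congr rfl fun j _ => ?_
      rw [mul_apply_eq_comp, cofactorPoly]
      congr 3
      rw [Finset.compl_eq_univ_sdiff, Finset.sdiff_singleton_eq_erase]
    rw [Finset.sum_eq_single i (fun j _ hj => by rw [h j hj, map_zero])
      (fun h => absurd (Finset.mem_univ i) h)] at h1
    rw [h1, aeval_comm_apply, aeval_comm_apply T (eigenPoly n l i), cofactor_eigen_apply hT,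
      map_zero]

theorem eq_zero_of_cofactor_eq_zero (hl : Function.Injective l)
    (hT : aeval T (∏ i, eigenPoly n l i) = 0) {v : E}
    (hv : ∀ j, aeval T (cofactorPoly n l j) v = 0) : v = 0 := by
  rcases isEmpty_or_nonempty (Fin s) with hs | ⟨⟨i⟩⟩
  -- With no eigenvalues the product is empty, and `hT` says that the identity of `E` is zero.
  · rw [Finset.univ_eq_empty, Finset.prod_empty, map_one] at hT
    exact congrArg (fun S : E →L[ℝ] E => S v) hT
  · obtain ⟨p, q, hpq⟩ := exists_bezout n T hl i
    rw [← hpq v, hv i, (eigen_eq_zero_iff hl hT i v).2 fun j _ => hv j, map_zero, map_zero,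
      add_zero]

end Decomposition

end Spectral

/-! ### Vanishing of intertwining maps -/

section Torsion

variable {E : Type} [NormedAddCommGroup E] [NormedSpace ℝ E]

/-- A bilinear expression intertwining `T` on its first argument and its values is zero if some
polynomial in `T` kills the values and is surjective on the arguments. -/
theorem eq_zero_of_intertwining {S : Set E} (T : E →L[ℝ] E) (p : Polynomial ℝ)
    (hS : ∀ x ∈ S, T x ∈ S) (hp : ∀ x ∈ S, ∃ y ∈ S, Polynomial.aeval T p y = x)
    (b : E →ₗ[ℝ] E) (hb : ∀ x ∈ S, Polynomial.aeval T p (b x) = 0)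
    (hT : ∀ x ∈ S, T (b x) = b (T x)) : ∀ x ∈ S, b x = 0 := by
  have hpow : ∀ k : ℕ, ∀ x ∈ S, (T ^ k) x ∈ S ∧ (T ^ k) (b x) = b ((T ^ k) x) := by
    intro k
    induction k with
    | zero => intro x hx; exact ⟨hx, rfl⟩
    | succ k ih =>
      intro x hx
      rw [pow_succ']
      refine ⟨hS _ (ih x hx).1, ?_⟩
      rw [mul_apply_eq_comp, (ih x hx).2, hT _ (ih x hx).1]
      rfl
  intro x hx
  obtain ⟨y, hy, rfl⟩ := hp x hx
  have h1 : Polynomial.aeval T p (b y) = b (Polynomial.aeval T p y) := by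
    rw [Polynomial.aeval_eq_sum_range, sum_apply,
      sum_apply, map_sum]
    refine Finset.sum_congr rfl fun k _ => ?_
    rw [smul_apply, smul_apply, map_smul,
      (hpow k y hy).2]
  rw [← h1, hb y hy]

end Torsion

/-! ### Smoothness of eigenvalues of constant multiplicity -/

section SmoothEigenvalues

open Polynomial

variable {E : Type} [NormedAddCommGroup E] [NormedSpace ℝ E]

/-- All coefficients of a family of polynomials are smooth on `Ω`. -/
def HasSmoothCoeffs (p : E → ℝ[X]) (Ω : Set E) : Prop :=
  ∀ k, ContDiffOn ℝ ∞ (fun x => (p x).coeff k) Ω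

theorem HasSmoothCoeffs.const (q : ℝ[X]) (Ω : Set E) : HasSmoothCoeffs (fun _ => q) Ω :=
  fun _ => contDiffOn_const

theorem HasSmoothCoeffs.sub {p q : E → ℝ[X]} {Ω : Set E} (hp : HasSmoothCoeffs p Ω)
    (hq : HasSmoothCoeffs q Ω) : HasSmoothCoeffs (fun x => p x - q x) Ω := fun k => by
  simpa only [coeff_sub] using (hp k).sub (hq k)

theorem HasSmoothCoeffs.mul {p q : E → ℝ[X]} {Ω : Set E} (hp : HasSmoothCoeffs p Ω)
    (hq : HasSmoothCoeffs q Ω) : HasSmoothCoeffs (fun x => p x * q x) Ω := fun k => by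
  simp only [coeff_mul]
  exact ContDiffOn.sum fun i _ => (hp i.1).mul (hq i.2)

theorem HasSmoothCoeffs.C {f : E → ℝ} {Ω : Set E} (hf : ContDiffOn ℝ ∞ f Ω) :
    HasSmoothCoeffs (fun x => Polynomial.C (f x)) Ω := fun k => by
  simp only [coeff_C]
  split_ifs
  · exact hf
  · exact contDiffOn_const

theorem HasSmoothCoeffs.sum {ι : Type*} {p : ι → E → ℝ[X]} {Ω : Set E} (S : Finset ι)
    (hp : ∀ i, HasSmoothCoeffs (p i) Ω) : HasSmoothCoeffs (fun x => ∑ i ∈ S, p i x) Ω :=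
  fun k => by
  simp only [finsetSum_coeff]
  exact ContDiffOn.sum fun i _ => hp i k

theorem HasSmoothCoeffs.prod {ι : Type*} {p : ι → E → ℝ[X]} {Ω : Set E} (S : Finset ι)
    (hp : ∀ i, HasSmoothCoeffs (p i) Ω) : HasSmoothCoeffs (fun x => ∏ i ∈ S, p i x) Ω := by
  classical
  induction S using Finset.induction_on with
  | empty => simpa using HasSmoothCoeffs.const 1 Ω
  | insert i S hi ih =>
    simp only [Finset.prod_insert hi]
    exact (hp i).mul ih

theorem HasSmoothCoeffs.iterate_derivative {p : E → ℝ[X]} {Ω : Set E}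
    (hp : HasSmoothCoeffs p Ω) (m : ℕ) : HasSmoothCoeffs (fun x => derivative^[m] (p x)) Ω := by
  induction m with
  | zero => exact hp
  | succ m ih =>
    intro k
    simp only [Function.iterate_succ_apply', coeff_derivative]
    exact (ih (k + 1)).mul contDiffOn_const

theorem HasSmoothCoeffs.charpoly {ι : Type*} [Fintype ι] [DecidableEq ι] {A : E → Matrix ι ι ℝ}
    {Ω : Set E} (hA : ∀ i j, ContDiffOn ℝ ∞ (fun x => A x i j) Ω) :
    HasSmoothCoeffs (fun x => (A x).charpoly) Ω := by
  simp only [Matrix.charpoly, Matrix.det_apply]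
  refine HasSmoothCoeffs.sum _ fun σ => ?_
  have h1 : HasSmoothCoeffs (fun x => ∏ i, (A x).charmatrix (σ i) i) Ω := by
    refine HasSmoothCoeffs.prod _ fun i => ?_
    simp only [Matrix.charmatrix_apply]
    exact (HasSmoothCoeffs.const _ Ω).sub (HasSmoothCoeffs.C (hA _ _))
  intro k
  simp only [coeff_smul]
  exact (h1 k).const_smul _

/-- Evaluation is jointly smooth. -/
theorem HasSmoothCoeffs.contDiffOn_eval {p : E → ℝ[X]} {Ω : Set E} (hp : HasSmoothCoeffs p Ω)
    (d : ℕ) (hd : ∀ x, (p x).natDegree < d) :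
    ContDiffOn ℝ ∞ (fun q : E × ℝ => (p q.1).eval q.2) (Prod.fst ⁻¹' Ω) := by
  have : (fun q : E × ℝ => (p q.1).eval q.2)
      = fun q => ∑ k ∈ Finset.range d, (p q.1).coeff k * q.2 ^ k :=
    funext fun q => eval_eq_sum_range' (hd q.1) _
  rw [this]
  exact ContDiffOn.sum fun k _ => ((hp k).comp contDiff_fst.contDiffOn fun _ h => h).mul
    ((contDiff_snd.pow k).contDiffOn)

/-- A continuous root of constant multiplicity of a smooth family of polynomials is smooth. -/
theorem contDiffOn_root [FiniteDimensional ℝ E] {p : E → ℝ[X]} {Ω : Set E} (hΩ : IsOpen Ω)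
    (hp : HasSmoothCoeffs p Ω) (d : ℕ) (hd : ∀ x, (p x).natDegree < d) (hp0 : ∀ x, p x ≠ 0)
    {l : E → ℝ} (hl : ContinuousOn l Ω) {r : ℕ}
    (hr : ∀ x ∈ Ω, (p x).rootMultiplicity (l x) = r + 1) : ContDiffOn ℝ ∞ l Ω := by
  have : CompleteSpace E := FiniteDimensional.complete ℝ E
  intro x₀ hx₀
  refine ContDiffAt.contDiffWithinAt ?_
  -- A root of multiplicity `r + 1` of `p x` is a simple root of the `r`-th derivative, so the
  -- implicit function theorem applies to `q`. Continuity of `l` is what selects the branch produced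
  -- there.
  let q : E → ℝ[X] := fun x => derivative^[r] (p x)
  have hq : HasSmoothCoeffs q Ω := hp.iterate_derivative r
  have hqd : ∀ x, (q x).natDegree < d := fun x =>
    ((natDegree_iterate_derivative _ _).trans (Nat.sub_le _ _)).trans_lt (hd x)
  have hroot : ∀ x ∈ Ω, (q x).eval (l x) = 0 := fun x hx =>
    (lt_rootMultiplicity_iff_isRoot_iterate_derivative (hp0 x)).1
      (by rw [hr x hx]; exact Nat.lt_succ_self r) r le_rfl
  have hsimple : (derivative (q x₀)).eval (l x₀) ≠ 0 := by
    intro h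
    have h1 : r + 1 < (p x₀).rootMultiplicity (l x₀) := by
      rw [lt_rootMultiplicity_iff_isRoot_iterate_derivative (hp0 x₀)]
      intro m hm
      rcases Nat.lt_or_ge m (r + 1) with h2 | h2
      · exact (lt_rootMultiplicity_iff_isRoot_iterate_derivative (hp0 x₀)).1
          (by rw [hr x₀ hx₀]; exact Nat.lt_succ_self r) m (Nat.lt_succ_iff.1 h2)
      · rw [le_antisymm hm h2, Function.iterate_succ_apply']
        exact h
    rw [hr x₀ hx₀] at h1
    exact lt_irrefl _ h1
  let F : E × ℝ → ℝ := fun z => (q z.1).eval z.2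
  have hO : IsOpen (Prod.fst ⁻¹' Ω : Set (E × ℝ)) := hΩ.preimage continuous_fst
  have hF : ContDiffOn ℝ ∞ F (Prod.fst ⁻¹' Ω) := hq.contDiffOn_eval d hqd
  let Ψ : E × ℝ → E × ℝ := fun z => (z.1, F z)
  have hΨ : ContDiffOn ℝ ∞ Ψ (Prod.fst ⁻¹' Ω) := contDiff_fst.contDiffOn.prodMk hF
  let z₀ : E × ℝ := (x₀, l x₀)
  have hFd : HasFDerivAt F (fderiv ℝ F z₀) z₀ :=
    ((hF.contDiffAt (hO.mem_nhds hx₀)).differentiableAt (by simp)).hasFDerivAt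
  have hΨd : HasFDerivAt Ψ ((ContinuousLinearMap.fst ℝ E ℝ).prod (fderiv ℝ F z₀)) z₀ :=
    hasFDerivAt_fst.prodMk hFd
  have hFt : fderiv ℝ F z₀ (0, 1) = (derivative (q x₀)).eval (l x₀) := by
    have h1 : HasFDerivAt (fun t => F (x₀, t)) _ (l x₀) :=
      HasFDerivAt.comp (g := F) (f := fun t : ℝ => (x₀, t)) (l x₀) hFd
        ((hasFDerivAt_const x₀ (l x₀)).prodMk (hasFDerivAt_id (l x₀)))
    exact h1.hasDerivAt.unique ((q x₀).hasDerivAt (l x₀))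
  have hinv : (fderiv ℝ Ψ z₀).IsInvertible := by
    rw [hΨd.fderiv]
    refine isInvertible_of_injective _ ?_ rfl
    rw [injective_iff_map_eq_zero]
    rintro ⟨h, τ⟩ hz
    have h1 : h = 0 := congrArg Prod.fst hz
    have h2 : fderiv ℝ F z₀ (h, τ) = 0 := congrArg Prod.snd hz
    have h3 : ((h, τ) : E × ℝ) = τ • ((0 : E), (1 : ℝ)) := by simp [h1]
    rw [h3, map_smul, hFt, smul_eq_mul, mul_eq_zero, or_iff_left hsimple] at h2
    rw [h1, h2]
    rfl
  obtain ⟨e, he₀, heO, heΨ, -, hesymm⟩ := exists_smooth_local_inverse hO hΨ (a := z₀) hx₀ hinv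
  have hev : l =ᶠ[𝓝 x₀] fun x => (e.symm (x, 0)).2 := by
    have hc : ContinuousAt (fun x => (x, l x)) x₀ :=
      continuousAt_id.prodMk (hl.continuousAt (hΩ.mem_nhds hx₀))
    filter_upwards [hc.preimage_mem_nhds (e.open_source.mem_nhds he₀), hΩ.mem_nhds hx₀]
      with x hx hxΩ
    have h1 : e (x, l x) = (x, 0) := by
      rw [heΨ]
      exact Prod.ext rfl (hroot x hxΩ)
    rw [← h1, e.left_inv hx]
  refine ContDiffAt.congr_of_eventuallyEq ?_ hev
  have h1 : (x₀, (0 : ℝ)) ∈ e.target := by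
    have h2 : e z₀ = (x₀, 0) := by
      rw [heΨ]
      exact Prod.ext rfl (hroot x₀ hx₀)
    rw [← h2]
    exact e.map_source he₀
  exact contDiff_snd.contDiffAt.comp x₀ (((hesymm.contDiffAt (e.open_target.mem_nhds h1))).comp x₀
    (contDiff_id.prodMk contDiff_const).contDiffAt)

/-- A continuous eigenvalue of constant algebraic multiplicity is smooth. -/
theorem contDiffOn_eigenvalue [FiniteDimensional ℝ E] {T : E → E →L[ℝ] E} {Ω : Set E}
    (hΩ : IsOpen Ω) (hT : ContDiffOn ℝ ∞ T Ω) {l : E → ℝ} (hl : ContinuousOn l Ω)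
    (hev : ∀ x ∈ Ω, Module.End.HasEigenvalue (T x : Module.End ℝ E) (l x)) {r : ℕ}
    (hr : ∀ x ∈ Ω, Module.finrank ℝ
      (Module.End.maxGenEigenspace (T x : Module.End ℝ E) (l x)) = r) : ContDiffOn ℝ ∞ l Ω := by
  rcases Ω.eq_empty_or_nonempty with rfl | ⟨y, hy⟩
  · exact contDiffOn_empty
  -- The dimension of the generalized eigenspace is the algebraic multiplicity, so constant rank
  -- means constant root multiplicity.
  have hmul : ∀ x ∈ Ω, (T x : Module.End ℝ E).charpoly.rootMultiplicity (l x) = r := fun x hx => by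
    rw [← LinearMap.finrank_maxGenEigenspace_eq, hr x hx]
  have hr0 : r ≠ 0 := by
    rw [← hmul y hy]
    refine ((rootMultiplicity_pos (LinearMap.charpoly_monic _).ne_zero).2 ?_).ne'
    exact (Module.End.hasEigenvalue_iff_isRoot_charpoly _ _).1 (hev y hy)
  obtain ⟨m, rfl⟩ := Nat.exists_eq_succ_of_ne_zero hr0
  let b := Module.finBasis ℝ E
  refine contDiffOn_root hΩ (p := fun x => (T x : Module.End ℝ E).charpoly) ?_
    (Module.finrank ℝ E + 1) (fun x => by rw [LinearMap.charpoly_natDegree]; exact Nat.lt_succ_self _)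
    (fun x => (LinearMap.charpoly_monic _).ne_zero) hl hmul
  have h1 : ∀ x, (T x : Module.End ℝ E).charpoly
      = (LinearMap.toMatrix b b (T x : Module.End ℝ E)).charpoly := fun x =>
    (LinearMap.charpoly_toMatrix _ b).symm
  simp only [h1]
  refine HasSmoothCoeffs.charpoly fun i j => ?_
  simp only [LinearMap.toMatrix_apply]
  exact (LinearMap.toContinuousLinearMap (b.coord i)).contDiff.comp_contDiffOn
    (hT.clm_apply contDiffOn_const)

end SmoothEigenvalues

/-! ### Torsions on a vector space, and involutivity from vanishing Haantjes torsion -/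

section CoordinateTorsion

variable {E : Type} [NormedAddCommGroup E] [NormedSpace ℝ E]

/-- The Nijenhuis torsion of an operator field on a vector space. -/
noncomputable def vectorNijenhuis (L : E → E →L[ℝ] E) (X Y : E → E) : E → E := fun x =>
  L x (L x (VectorField.lieBracket ℝ X Y x))
    + VectorField.lieBracket ℝ (fun y => L y (X y)) (fun y => L y (Y y)) x
    - L x (VectorField.lieBracket ℝ X (fun y => L y (Y y)) x
        + VectorField.lieBracket ℝ (fun y => L y (X y)) Y x)

/-- The Haantjes torsion of an operator field on a vector space. -/
noncomputable def vectorHaantjes (L : E → E →L[ℝ] E) (X Y : E → E) : E → E := fun x =>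
  L x (L x (vectorNijenhuis L X Y x))
    + vectorNijenhuis L (fun y => L y (X y)) (fun y => L y (Y y)) x
    - L x (vectorNijenhuis L X (fun y => L y (Y y)) x
        + vectorNijenhuis L (fun y => L y (X y)) Y x)

end CoordinateTorsion

section Involutive

open Polynomial

variable {E : Type} [NormedAddCommGroup E] [NormedSpace ℝ E]

/-- The defect of `β` from intertwining `τ` on the first argument and the values. -/
def leftDefect (τ : E →ₗ[ℝ] E) (β : E →ₗ[ℝ] E →ₗ[ℝ] E) : E →ₗ[ℝ] E →ₗ[ℝ] E :=
  β.compr₂ τ - β.comp τ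

/-- The defect of `β` from intertwining `τ` on the second argument and the values. -/
def rightDefect (τ : E →ₗ[ℝ] E) (β : E →ₗ[ℝ] E →ₗ[ℝ] E) : E →ₗ[ℝ] E →ₗ[ℝ] E :=
  β.compr₂ τ - β.compl₂ τ

@[simp] theorem leftDefect_apply (τ : E →ₗ[ℝ] E) (β : E →ₗ[ℝ] E →ₗ[ℝ] E) (a b : E) :
    leftDefect τ β a b = τ (β a b) - β (τ a) b := rfl

@[simp] theorem rightDefect_apply (τ : E →ₗ[ℝ] E) (β : E →ₗ[ℝ] E →ₗ[ℝ] E) (a b : E) :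
    rightDefect τ β a b = τ (β a b) - β a (τ b) := rfl

section

variable {S : Set E} (T : E →L[ℝ] E) (p : ℝ[X]) (hS : ∀ x ∈ S, T x ∈ S)
  (hp : ∀ x ∈ S, ∃ y ∈ S, aeval T p y = x)

theorem aeval_apply_self (v : E) : aeval T p (T v) = T (aeval T p v) := by
  have := aeval_comm_apply T p X v
  rwa [aeval_X] at this

include hS in
theorem leftDefect_killed (β : E →ₗ[ℝ] E →ₗ[ℝ] E)
    (hβ : ∀ a ∈ S, ∀ b ∈ S, aeval T p (β a b) = 0) :
    ∀ a ∈ S, ∀ b ∈ S, aeval T p (leftDefect (T : E →ₗ[ℝ] E) β a b) = 0 := by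
  intro a ha b hb
  rw [leftDefect_apply, map_sub]
  change aeval T p (T (β a b)) - aeval T p (β (T a) b) = 0
  rw [aeval_apply_self, hβ a ha b hb, hβ _ (hS a ha) b hb, map_zero, sub_zero]

include hS in
theorem rightDefect_killed (β : E →ₗ[ℝ] E →ₗ[ℝ] E)
    (hβ : ∀ a ∈ S, ∀ b ∈ S, aeval T p (β a b) = 0) :
    ∀ a ∈ S, ∀ b ∈ S, aeval T p (rightDefect (T : E →ₗ[ℝ] E) β a b) = 0 := by
  intro a ha b hb
  rw [rightDefect_apply, map_sub]
  change aeval T p (T (β a b)) - aeval T p (β a (T b)) = 0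
  rw [aeval_apply_self, hβ a ha b hb, hβ a ha _ (hS b hb), map_zero, sub_zero]

include hS hp in
theorem eq_zero_of_leftDefect (β : E →ₗ[ℝ] E →ₗ[ℝ] E)
    (hβ : ∀ a ∈ S, ∀ b ∈ S, aeval T p (β a b) = 0)
    (h : ∀ a ∈ S, ∀ b ∈ S, leftDefect (T : E →ₗ[ℝ] E) β a b = 0) :
    ∀ a ∈ S, ∀ b ∈ S, β a b = 0 := fun a ha b hb =>
  eq_zero_of_intertwining T p hS hp (β.flip b) (fun x hx => hβ x hx b hb)
    (fun x hx => sub_eq_zero.1 (h x hx b hb)) a ha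

include hS hp in
theorem eq_zero_of_rightDefect (β : E →ₗ[ℝ] E →ₗ[ℝ] E)
    (hβ : ∀ a ∈ S, ∀ b ∈ S, aeval T p (β a b) = 0)
    (h : ∀ a ∈ S, ∀ b ∈ S, rightDefect (T : E →ₗ[ℝ] E) β a b = 0) :
    ∀ a ∈ S, ∀ b ∈ S, β a b = 0 := fun a ha b hb =>
  eq_zero_of_intertwining T p hS hp (β a) (fun x hx => hβ a ha x hx)
    (fun x hx => sub_eq_zero.1 (h a ha x hx)) b hb

-- Each defect of `β` again has its values killed by `p(T)`. A vanishing outermost defect means that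
-- the form inside intertwines `T` in one argument, hence is zero; this is repeated four times.
include hS hp in
theorem eq_zero_of_defects (β : E →ₗ[ℝ] E →ₗ[ℝ] E)
    (hβ : ∀ a ∈ S, ∀ b ∈ S, aeval T p (β a b) = 0)
    (h : ∀ a ∈ S, ∀ b ∈ S, leftDefect (T : E →ₗ[ℝ] E) (leftDefect T
      (rightDefect T (rightDefect T β))) a b = 0) : ∀ a ∈ S, ∀ b ∈ S, β a b = 0 := by
  have h1 := rightDefect_killed T p hS β hβ
  have h2 := rightDefect_killed T p hS _ h1
  have h3 := leftDefect_killed T p hS _ h2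
  exact eq_zero_of_rightDefect T p hS hp β hβ (eq_zero_of_rightDefect T p hS hp _ h1
    (eq_zero_of_leftDefect T p hS hp _ h2 (eq_zero_of_leftDefect T p hS hp _ h3 h)))

end

section

variable {s : ℕ} {Ω : Set E} {L : E → E →L[ℝ] E} {l : Fin s → E → ℝ}

theorem contDiffOn_aeval_eigenPoly (n : ℕ) (hL : ContDiffOn ℝ ∞ L Ω)
    (hl : ∀ i, ContDiffOn ℝ ∞ (l i) Ω) (i : Fin s) :
    ContDiffOn ℝ ∞ (fun x => aeval (L x) (eigenPoly n (fun i => l i x) i)) Ω := by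
  have : ∀ x, aeval (L x) (eigenPoly n (fun i => l i x) i)
      = (L x - l i x • ContinuousLinearMap.id ℝ E) ^ n := fun x => by
    rw [eigenPoly, map_pow, map_sub, aeval_X, aeval_C, Algebra.algebraMap_eq_smul_one]
    rfl
  simp only [this]
  exact (hL.sub ((hl i).smul contDiffOn_const)).pow n

theorem contDiffOn_aeval_cofactorPoly (n : ℕ) (hL : ContDiffOn ℝ ∞ L Ω)
    (hl : ∀ i, ContDiffOn ℝ ∞ (l i) Ω) (i : Fin s) :
    ContDiffOn ℝ ∞ (fun x => aeval (L x) (cofactorPoly n (fun i => l i x) i)) Ω := by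
  unfold cofactorPoly
  induction Finset.univ.erase i using Finset.induction_on with
  | empty =>
    simp only [Finset.prod_empty, map_one]
    exact contDiffOn_const
  | insert j S hj ih =>
    simp only [Finset.prod_insert hj, map_mul]
    exact (contDiffOn_aeval_eigenPoly n hL hl j).clm_comp ih

/-- On sections of the kernel of `Q`, the bracket followed by `Q` is tensorial. -/
theorem apply_lieBracket_eq {Q : E → E →L[ℝ] E} (hΩ : IsOpen Ω) (hQ : ContDiffOn ℝ ∞ Q Ω)
    {X Y : E → E} (hX : ContDiffOn ℝ ∞ X Ω) (hY : ContDiffOn ℝ ∞ Y Ω)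
    (hQX : ∀ x ∈ Ω, Q x (X x) = 0) (hQY : ∀ x ∈ Ω, Q x (Y x) = 0) {x : E} (hx : x ∈ Ω) :
    Q x (VectorField.lieBracket ℝ X Y x) = fderiv ℝ Q x (Y x) (X x) - fderiv ℝ Q x (X x) (Y x) := by
  -- Differentiating `Q Z = 0` moves the derivative from `Z` to `Q`; this is why no derivative of
  -- `X` or `Y` survives.
  have key : ∀ Z : E → E, ContDiffOn ℝ ∞ Z Ω → (∀ x ∈ Ω, Q x (Z x) = 0) → ∀ v,
      Q x (fderiv ℝ Z x v) = - fderiv ℝ Q x v (Z x) := by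
    intro Z hZ hQZ v
    have h1 := (((hQ.contDiffAt (hΩ.mem_nhds hx)).differentiableAt (by simp)).hasFDerivAt).clm_apply
      (((hZ.contDiffAt (hΩ.mem_nhds hx)).differentiableAt (by simp)).hasFDerivAt)
    have h2 : (fun x => Q x (Z x)) =ᶠ[𝓝 x] fun _ => 0 := by
      filter_upwards [hΩ.mem_nhds hx] with y hy using hQZ y hy
    have h3 := (h1.congr_of_eventuallyEq h2.symm).unique (hasFDerivAt_const 0 x)
    have h4 := congrArg (fun S => S v) h3
    exact eq_neg_of_add_eq_zero_left h4
  rw [VectorField.lieBracket, map_sub, key Y hY hQY, key X hX hQX]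
  abel

/-- If the Haantjes torsion vanishes, then the complement of a generalized eigenspace is
involutive. -/
theorem cofactor_lieBracket_eq_zero {n : ℕ} (hΩ : IsOpen Ω) (hL : ContDiffOn ℝ ∞ L Ω)
    (hl : ∀ i, ContDiffOn ℝ ∞ (l i) Ω)
    (hinj : ∀ x ∈ Ω, Function.Injective fun i => l i x)
    (hann : ∀ x ∈ Ω, aeval (L x) (∏ i, eigenPoly n (fun i => l i x) i) = 0)
    (hH : ∀ X Y : E → E, ContDiffOn ℝ ∞ X Ω → ContDiffOn ℝ ∞ Y Ω →
      ∀ x ∈ Ω, vectorHaantjes L X Y x = 0) (i : Fin s) {X Y : E → E}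
    (hX : ContDiffOn ℝ ∞ X Ω) (hY : ContDiffOn ℝ ∞ Y Ω)
    (hQX : ∀ x ∈ Ω, aeval (L x) (cofactorPoly n (fun i => l i x) i) (X x) = 0)
    (hQY : ∀ x ∈ Ω, aeval (L x) (cofactorPoly n (fun i => l i x) i) (Y x) = 0)
    {x : E} (hx : x ∈ Ω) :
    aeval (L x) (cofactorPoly n (fun i => l i x) i) (VectorField.lieBracket ℝ X Y x) = 0 := by
  set Q : E → E →L[ℝ] E := fun x => aeval (L x) (cofactorPoly n (fun i => l i x) i) with hQdef
  set A : E → E →L[ℝ] E := fun x => aeval (L x) (eigenPoly n (fun i => l i x) i)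
  have hQ : ContDiffOn ℝ ∞ Q Ω := contDiffOn_aeval_cofactorPoly n hL hl i
  have hA : ContDiffOn ℝ ∞ A Ω := contDiffOn_aeval_eigenPoly n hL hl i
  have hQA : ∀ y ∈ Ω, ∀ v, Q y (A y v) = 0 := fun y hy v => cofactor_eigen_apply (hann y hy) i v
  have hQL : ∀ y v, Q y (L y v) = L y (Q y v) := fun y v => aeval_apply_self (L y) _ v
  -- The pointwise form representing `Q [X, Y]` for sections of `ker Q`.
  let β : E →ₗ[ℝ] E →ₗ[ℝ] E :=
    LinearMap.mk₂ ℝ (fun a b => fderiv ℝ Q x b a - fderiv ℝ Q x a b)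
      (fun a a' b => by simp only [map_add, add_apply]; abel)
      (fun c a b => by simp only [map_smul, smul_apply, smul_sub])
      (fun a b b' => by simp only [map_add, add_apply]; abel)
      (fun c a b => by simp only [map_smul, smul_apply, smul_sub])
  have hβ : ∀ {X Y : E → E}, ContDiffOn ℝ ∞ X Ω → ContDiffOn ℝ ∞ Y Ω →
      (∀ y ∈ Ω, Q y (X y) = 0) → (∀ y ∈ Ω, Q y (Y y) = 0) →
      Q x (VectorField.lieBracket ℝ X Y x) = β (X x) (Y x) := fun hX hY hQX hQY =>
    apply_lieBracket_eq hΩ hQ hX hY hQX hQY hx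
  have hLs : ∀ {Z : E → E}, ContDiffOn ℝ ∞ Z Ω → ContDiffOn ℝ ∞ (fun y => L y (Z y)) Ω :=
    fun hZ => hL.clm_apply hZ
  have hLQ : ∀ {Z : E → E}, (∀ y ∈ Ω, Q y (Z y) = 0) → ∀ y ∈ Ω, Q y (L y (Z y)) = 0 :=
    fun hZ y hy => by rw [hQL, hZ y hy, map_zero]
  have hker : ∀ {a}, Q x a = 0 → ∃ u, A x u = a := fun {a} h =>
    (range_eigen_iff (hinj x hx) (hann x hx) i a).2 h
  -- A vector of `ker Q x` is `A x u` for some `u`, and `y ↦ A y u` extends it to a smooth section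
  -- of `ker Q`. The values `Q [X, Y]` of `β` are killed by `A`, since `A Q = 0`.
  have hkilled : ∀ a ∈ {v | Q x v = 0}, ∀ b ∈ {v | Q x v = 0}, A x (β a b) = 0 := by
    intro a ha b hb
    obtain ⟨u, rfl⟩ := hker ha
    obtain ⟨w, rfl⟩ := hker hb
    rw [← hβ (X := fun y => A y u) (Y := fun y => A y w) (hA.clm_apply contDiffOn_const)
      (hA.clm_apply contDiffOn_const) (fun y hy => hQA y hy u) (fun y hy => hQA y hy w)]
    change aeval (L x) _ (aeval (L x) _ _) = 0
    rw [aeval_comm_apply]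
    exact hQA x hx _
  have hdefect : ∀ a ∈ {v | Q x v = 0}, ∀ b ∈ {v | Q x v = 0},
      leftDefect (L x : E →ₗ[ℝ] E) (leftDefect (L x) (rightDefect (L x)
        (rightDefect (L x) β))) a b = 0 := by
    intro a ha b hb
    obtain ⟨u, rfl⟩ := hker ha
    obtain ⟨w, rfl⟩ := hker hb
    have hX0 : ContDiffOn ℝ ∞ (fun y => A y u) Ω := hA.clm_apply contDiffOn_const
    have hY0 : ContDiffOn ℝ ∞ (fun y => A y w) Ω := hA.clm_apply contDiffOn_const
    have hX1 := hLs hX0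
    have hY1 := hLs hY0
    have hX2 := hLs hX1
    have hY2 := hLs hY1
    have hQX0 : ∀ y ∈ Ω, Q y (A y u) = 0 := fun y hy => hQA y hy u
    have hQY0 : ∀ y ∈ Ω, Q y (A y w) = 0 := fun y hy => hQA y hy w
    have hQX1 := hLQ hQX0
    have hQY1 := hLQ hQY0
    have hQX2 := hLQ hQX1
    have hQY2 := hLQ hQY1
    -- `Q` commutes with `L`, and all fields in the brackets of `H_L` remain sections of `ker Q`, so
    -- every bracket becomes a value of `β`. The resulting sum is exactly the fourfold defect.
    have h1 := congrArg (Q x) (hH _ _ hX0 hY0 x hx)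
    simp only [vectorHaantjes, vectorNijenhuis, map_add, map_sub, hQL, map_zero] at h1
    rw [hβ hX0 hY0 hQX0 hQY0, hβ hX1 hY1 hQX1 hQY1, hβ hX0 hY1 hQX0 hQY1,
      hβ hX1 hY0 hQX1 hQY0, hβ hX2 hY2 hQX2 hQY2, hβ hX1 hY2 hQX1 hQY2,
      hβ hX2 hY1 hQX2 hQY1, hβ hX0 hY2 hQX0 hQY2, hβ hX2 hY0 hQX2 hQY0] at h1
    simp only [leftDefect_apply, rightDefect_apply, ContinuousLinearMap.coe_coe, map_sub]
    rw [← h1]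
    abel
  rw [hβ hX hY hQX hQY]
  refine eq_zero_of_defects (S := {v | Q x v = 0}) (L x) (eigenPoly n (fun i => l i x) i)
    ?_ ?_ β hkilled hdefect _ (hQX x hx) _ (hQY x hx)
  · intro v hv
    rw [mem_ofPred_eq] at hv ⊢
    rw [hQL, hv, map_zero]
  · intro v hv
    rw [mem_ofPred_eq] at hv
    obtain ⟨p, q, hpq⟩ := exists_bezout n (L x) (hinj x hx) i
    have h1 := hpq v
    change _ + aeval (L x) q (Q x v) = v at h1
    rw [hv, map_zero, add_zero, aeval_comm_apply] at h1
    refine ⟨_, ?_, h1⟩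
    change aeval (L x) _ (aeval (L x) p v) = 0
    rw [aeval_comm_apply]
    change aeval (L x) p (Q x v) = 0
    rw [hv, map_zero]

end

end Involutive

/-! ### Coordinates adapted to the generalized eigen-distributions -/

section AdaptedCoordinates

open Polynomial

/-- Spectral data of a smooth operator field on an open set of a vector space. -/
structure HasSpectrumOn {E : Type} [NormedAddCommGroup E] [NormedSpace ℝ E] {s : ℕ}
    (L : E → E →L[ℝ] E) (l : Fin s → E → ℝ) (r : Fin s → ℕ) (Ω : Set E) : Prop where
  smooth : ContDiffOn ℝ ∞ L Ω
  continuousOn : ∀ i, ContinuousOn (l i) Ω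
  injective : ∀ x ∈ Ω, Function.Injective fun i => l i x
  splits : ∀ x ∈ Ω, (minpoly ℝ (L x : Module.End ℝ E)).Splits
  hasEigenvalue_iff : ∀ x ∈ Ω, ∀ μ,
    Module.End.HasEigenvalue (L x : Module.End ℝ E) μ ↔ ∃ i, l i x = μ
  finrank_eq : ∀ i, ∀ x ∈ Ω,
    Module.finrank ℝ (Module.End.maxGenEigenspace (L x : Module.End ℝ E) (l i x)) = r i

variable {E : Type} [NormedAddCommGroup E] [NormedSpace ℝ E] [FiniteDimensional ℝ E]
  {s : ℕ} {L : E → E →L[ℝ] E} {l : Fin s → E → ℝ} {r : Fin s → ℕ} {Ω : Set E}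

theorem HasSpectrumOn.aeval_eq_zero (h : HasSpectrumOn L l r Ω) {x : E} (hx : x ∈ Ω) :
    aeval (L x) (∏ i, eigenPoly (Module.finrank ℝ E) (fun i => l i x) i) = 0 :=
  aeval_prod_eigenPoly_eq_zero (h.splits x hx) fun μ hμ => (h.hasEigenvalue_iff x hx μ).1 hμ

theorem HasSpectrumOn.contDiffOn (h : HasSpectrumOn L l r Ω) (hΩ : IsOpen Ω) (i : Fin s) :
    ContDiffOn ℝ ∞ (l i) Ω :=
  contDiffOn_eigenvalue hΩ h.smooth (h.continuousOn i)
    (fun x hx => (h.hasEigenvalue_iff x hx _).2 ⟨i, rfl⟩) (h.finrank_eq i)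

theorem HasSpectrumOn.ker_eigenPoly (h : HasSpectrumOn L l r Ω) {x : E} (hx : x ∈ Ω) (i : Fin s) :
    Module.finrank ℝ (LinearMap.ker
      ((aeval (L x) (eigenPoly (Module.finrank ℝ E) (fun i => l i x) i) : E →L[ℝ] E)
        : E →ₗ[ℝ] E)) = r i := by
  have h1 : LinearMap.ker
      ((aeval (L x) (eigenPoly (Module.finrank ℝ E) (fun i => l i x) i) : E →L[ℝ] E)
        : E →ₗ[ℝ] E) = Module.End.maxGenEigenspace (L x : Module.End ℝ E) (l i x) := by
    ext v
    exact (mem_maxGenEigenspace_iff (fun i => l i x) (L x) i v).symm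
  rw [h1, h.finrank_eq i x hx]

/-- Independence of the generalized eigenspaces: applying the `i`-th cofactor to `∑ v j = 0`
isolates `v i`, so all cofactors kill every `v j`. -/
theorem HasSpectrumOn.sum_rank_le (h : HasSpectrumOn L l r Ω) {x : E} (hx : x ∈ Ω) :
    ∑ i, r i ≤ Module.finrank ℝ E := by
  set n := Module.finrank ℝ E
  let D : Fin s → Submodule ℝ E := fun i => LinearMap.ker
      ((aeval (L x) (eigenPoly n (fun i => l i x) i) : E →L[ℝ] E) : E →ₗ[ℝ] E)
  have hann := h.aeval_eq_zero hx
  have hinj := h.injective x hx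
  let σ : (∀ i, D i) →ₗ[ℝ] E := ∑ i, (D i).subtype ∘ₗ LinearMap.proj i
  have hσ : Function.Injective σ := by
    rw [injective_iff_map_eq_zero]
    intro v hv
    have hv' : ∑ i, (v i : E) = 0 := by simpa [σ] using hv
    funext j
    refine Subtype.ext (eq_zero_of_cofactor_eq_zero hinj hann fun i => ?_)
    by_cases hij : i = j
    · subst hij
      have h1 := congrArg (aeval (L x) (cofactorPoly n (fun i => l i x) i)) hv'
      rw [map_sum, map_zero, Finset.sum_eq_single i (fun k _ hk =>
        (eigen_eq_zero_iff hinj hann k _).1 (v k).2 i hk.symm)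
        (fun h => absurd (Finset.mem_univ i) h)] at h1
      exact h1
    · exact (eigen_eq_zero_iff hinj hann j _).1 (v j).2 i hij
  have h1 := LinearMap.finrank_le_finrank_of_injective hσ
  rw [Module.finrank_pi_fintype] at h1
  rw [← Finset.sum_congr rfl fun i _ => h.ker_eigenPoly hx i]
  exact h1

/-- First integrals of the complement of a generalized eigen-distribution. -/
theorem HasSpectrumOn.exists_first_integrals (h : HasSpectrumOn L l r Ω) (hΩ : IsOpen Ω)
    (hH : ∀ Ω' ⊆ Ω, IsOpen Ω' → ∀ X Y : E → E, ContDiffOn ℝ ∞ X Ω' → ContDiffOn ℝ ∞ Y Ω' →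
      ∀ x ∈ Ω', vectorHaantjes L X Y x = 0) {x₀ : E} (hx₀ : x₀ ∈ Ω) (i : Fin s) :
    ∃ (V : Set E) (f : E → Fin (r i) → ℝ), IsOpen V ∧ x₀ ∈ V ∧ V ⊆ Ω ∧ ContDiffOn ℝ ∞ f V ∧
      ∀ x ∈ V, ∀ v, fderiv ℝ f x v = 0 ↔
        aeval (L x) (cofactorPoly (Module.finrank ℝ E) (fun i => l i x) i) v = 0 := by
  set n := Module.finrank ℝ E
  have hl := h.contDiffOn hΩ
  have hker : ∀ x ∈ Ω, ∀ v, (∃ u, aeval (L x) (eigenPoly n (fun i => l i x) i) u = v) ↔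
      aeval (L x) (cofactorPoly n (fun i => l i x) i) v = 0 := fun x hx v =>
    range_eigen_iff (h.injective x hx) (h.aeval_eq_zero hx) i v
  -- Frobenius is applied to the range of `P i (L)`, whose corank is the rank `r i` of the kernel;
  -- this yields `r i` first integrals.
  obtain ⟨V, f, hV, hxV, hVΩ, hf, hfd⟩ := Haantjes.exists_first_integrals hΩ
    (fun x => aeval (L x) (eigenPoly n (fun i => l i x) i))
    (contDiffOn_aeval_eigenPoly n h.smooth hl i) hx₀ (r := r i)
    (fun x hx => by
      rw [← h.ker_eigenPoly hx i]
      exact LinearMap.finrank_range_add_finrank_ker _)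
    (fun Ω' hΩΩ' hΩ' X Y hX hY hAX hAY x hx => (hker x (hΩΩ' hx) _).2 <|
      cofactor_lieBracket_eq_zero hΩ' (h.smooth.mono hΩΩ') (fun i => (hl i).mono hΩΩ')
        (fun x hx => h.injective x (hΩΩ' hx)) (fun x hx => h.aeval_eq_zero (hΩΩ' hx))
        (hH Ω' hΩΩ' hΩ') i hX hY (fun x hx => (hker x (hΩΩ' hx) _).1 (hAX x hx))
        (fun x hx => (hker x (hΩΩ' hx) _).1 (hAY x hx)) hx)
  exact ⟨V, f, hV, hxV, hVΩ, hf, fun x hx v => (hfd x hx v).trans (hker x (hVΩ hx) v)⟩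

theorem exists_monotone_enumeration {s n : ℕ} (r : Fin s → ℕ) (h : ∑ i, r i = n) :
    ∃ e : Fin n ≃ Σ i, Fin (r i), Monotone fun k => (e k).1 := by
  have hc : Fintype.card (Fin n) = Fintype.card (Σ i, Fin (r i)) := by simp [h]
  let e₀ := Fintype.equivOfCardEq hc
  exact ⟨(Tuple.sort fun k => (e₀ k).1).trans e₀, Tuple.monotone_sort fun k => (e₀ k).1⟩

/-- Coordinates adapted to the generalized eigen-distributions of an operator field with
vanishing Haantjes torsion. -/
theorem exists_adapted_coordinates {n : ℕ} {L : Coord n → Coord n →L[ℝ] Coord n}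
    {l : Fin s → Coord n → ℝ} {Ω : Set (Coord n)} (h : HasSpectrumOn L l r Ω) (hΩ : IsOpen Ω)
    (hH : ∀ Ω' ⊆ Ω, IsOpen Ω' → ∀ X Y : Coord n → Coord n, ContDiffOn ℝ ∞ X Ω' →
      ContDiffOn ℝ ∞ Y Ω' → ∀ x ∈ Ω', vectorHaantjes L X Y x = 0)
    {x₀ : Coord n} (hx₀ : x₀ ∈ Ω) :
    ∃ (e : OpenPartialHomeomorph (Coord n) (Coord n)) (p : Fin n → Fin s), Monotone p ∧
      x₀ ∈ e.source ∧ e.source ⊆ Ω ∧ ContDiffOn ℝ ∞ e e.source ∧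
      ContDiffOn ℝ ∞ e.symm e.target ∧
      ∀ x ∈ e.source, ∀ i v, v ∈ Module.End.maxGenEigenspace (L x : Module.End ℝ (Coord n)) (l i x)
        ↔ ∀ k, p k ≠ i → fderiv ℝ e x v k = 0 := by
  choose V f hV hxV hVΩ hf hfd using fun i => h.exists_first_integrals hΩ hH hx₀ i
  set N := Module.finrank ℝ (Coord n) with hNdef
  have hN : N = n := finrank_euclideanSpace_fin
  let W : Set (Coord n) := Ω ∩ ⋂ i, V i
  have hW : IsOpen W := hΩ.inter (isOpen_iInter_of_finite hV)
  have hxW : x₀ ∈ W := ⟨hx₀, mem_iInter.2 hxV⟩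
  have hWV : ∀ i, W ⊆ V i := fun i x hx => mem_iInter.1 hx.2 i
  have hfD : ∀ i, ∀ x ∈ W, HasFDerivAt (f i) (fderiv ℝ (f i) x) x := fun i x hx =>
    (((hf i).contDiffAt ((hV i).mem_nhds (hWV i hx))).differentiableAt (by simp)).hasFDerivAt
  have hzero : ∀ x ∈ W, ∀ v, (∀ i, fderiv ℝ (f i) x v = 0) → v = 0 := fun x hx v hv =>
    eq_zero_of_cofactor_eq_zero (h.injective x hx.1) (h.aeval_eq_zero hx.1)
      fun i => (hfd i x (hWV i hx) v).1 (hv i)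
  -- One inequality is independence of the eigenspaces; the other holds because the differentials of
  -- all the `f i` are jointly injective.
  have hsum : ∑ i, r i = n := by
    refine le_antisymm ((h.sum_rank_le hx₀).trans_eq hN) ?_
    have h1 := LinearMap.finrank_le_finrank_of_injective
      (f := LinearMap.pi fun i => (fderiv ℝ (f i) x₀ : Coord n →ₗ[ℝ] Fin (r i) → ℝ)) (by
        rw [injective_iff_map_eq_zero]
        exact fun v hv => hzero x₀ hxW v fun i => congrFun hv i)
    rw [Module.finrank_pi_fintype] at h1
    simp only [Module.finrank_fin_fun] at h1
    rw [← hNdef, hN] at h1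
    exact h1
  -- Coordinates are numbered in the order of their eigenvalue index, so that the blocks are
  -- consecutive.
  obtain ⟨ε, hε⟩ := exists_monotone_enumeration r hsum
  let F : Coord n → Coord n := fun x => WithLp.toLp 2 fun k => f (ε k).1 x (ε k).2
  have hF : ContDiffOn ℝ ∞ F W := by
    rw [contDiffOn_euclidean]
    intro k
    exact (contDiffOn_pi.1 ((hf (ε k).1).mono (hWV _))) (ε k).2
  have hFd : ∀ x ∈ W, ∀ v k, fderiv ℝ F x v k = fderiv ℝ (f (ε k).1) x v (ε k).2 := by
    intro x hx v k
    have h1 : HasFDerivAt F (fderiv ℝ F x) x :=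
      ((hF.contDiffAt (hW.mem_nhds hx)).differentiableAt (by simp)).hasFDerivAt
    have h2 := (EuclideanSpace.proj k : Coord n →L[ℝ] ℝ).hasFDerivAt.comp x h1
    have h3 := (hasFDerivAt_pi'.1 (hfD (ε k).1 x hx)) (ε k).2
    exact congrArg (fun T => T v) (h2.unique h3)
  have hinv : (fderiv ℝ F x₀).IsInvertible := by
    refine isInvertible_of_injective _ ?_ rfl
    rw [injective_iff_map_eq_zero]
    intro v hv
    refine hzero x₀ hxW v fun i => funext fun m => ?_
    have h1 := hFd x₀ hxW v (ε.symm ⟨i, m⟩)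
    rw [hv] at h1
    rw [Equiv.apply_symm_apply] at h1
    exact h1.symm
  obtain ⟨e, he₀, heW, heF, -, hesymm⟩ := exists_smooth_local_inverse hW hF hxW hinv
  have heF' : (e : Coord n → Coord n) = F := funext heF
  refine ⟨e, fun k => (ε k).1, hε, he₀, heW.trans inter_subset_left, ?_, hesymm, ?_⟩
  · rw [heF']
    exact hF.mono heW
  · intro x hx i v
    have hxW := heW hx
    rw [mem_maxGenEigenspace_iff (fun i => l i x), heF',
      eigen_eq_zero_iff (h.injective x hxW.1) (h.aeval_eq_zero hxW.1)]
    constructor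
    · intro hv k hk
      rw [hFd x hxW, (hfd _ x (hWV _ hxW) v).2 (hv _ hk)]
      rfl
    · intro hv j hj
      rw [← hfd j x (hWV j hxW) v]
      funext m
      have h1 := hFd x hxW v (ε.symm ⟨j, m⟩)
      rw [hv _ (by simpa using hj), Equiv.apply_symm_apply] at h1
      exact h1.symm

end AdaptedCoordinates

theorem two_le_infty : (2 : WithTop ℕ∞) ≤ ∞ := by
  exact WithTop.coe_le_coe.2 (le_top : (2 : ℕ∞) ≤ ⊤)

theorem mlieBracket_eq_lieBracket {n : ℕ} (X Y : Coord n → Coord n) (y : Coord n) :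
    VectorField.mlieBracket 𝓘(ℝ, Coord n) X Y y = VectorField.lieBracket ℝ X Y y := by
  have h1 := VectorField.mlieBracketWithin_eq_lieBracketWithin (𝕜 := ℝ) (E := Coord n) (V := X) (W := Y)
    (s := univ)
  have h2 := VectorField.mlieBracketWithin_univ (I := 𝓘(ℝ, Coord n)) (V := X) (W := Y)
  exact ((congrFun h2 y).symm.trans (congrFun h1 y)).trans
    (congrFun (VectorField.lieBracketWithin_univ (𝕜 := ℝ) (V := X) (W := Y)) y)

/-! ### Fields, operators and torsions read in a chart -/

section Transfer

variable {n : ℕ} {M : Type*} [TopologicalSpace M] [ChartedSpace (Coord n) M]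

/-- The differential of a chart. -/
noncomputable def chartDeriv (φ : OpenPartialHomeomorph M (Coord n)) (x : M) :
    TangentSpace (𝓡 n) x →L[ℝ] Coord n :=
  mfderiv (𝓡 n) 𝓘(ℝ, Coord n) φ x

/-- The vector field on `M` represented by `X` in the chart `φ`. -/
noncomputable def pullField (φ : OpenPartialHomeomorph M (Coord n)) (X : Coord n → Coord n) :
    VField n M :=
  VectorField.mpullback (𝓡 n) 𝓘(ℝ, Coord n) φ X

/-- The expression of a vector field in the chart `φ`. -/
noncomputable def pushField (φ : OpenPartialHomeomorph M (Coord n)) (X : VField n M) :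
    Coord n → Coord n :=
  fun y => chartDeriv φ (φ.symm y) (X (φ.symm y))

theorem pullField_apply (φ : OpenPartialHomeomorph M (Coord n)) (X : Coord n → Coord n) (x : M) :
    pullField φ X x = (chartDeriv φ x).inverse (X (φ x)) := rfl

theorem naturalFrame_apply (φ : OpenPartialHomeomorph M (Coord n)) (k : Fin n) (x : M) :
    naturalFrame φ k x = (chartDeriv φ x).inverse (EuclideanSpace.single k 1) := rfl

variable [IsManifold (𝓡 n) ∞ M]

/-- The expression of an operator field in the chart `φ`. -/
noncomputable def pushOp (φ : OpenPartialHomeomorph M (Coord n)) (L : OperatorField n M) :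
    Coord n → Coord n →L[ℝ] Coord n :=
  fun y => chartDeriv φ (φ.symm y) ∘L L.op (φ.symm y) ∘L (chartDeriv φ (φ.symm y)).inverse

variable {φ : OpenPartialHomeomorph M (Coord n)}
  (hφ : φ ∈ IsManifold.maximalAtlas (𝓡 n) ∞ M) {L : OperatorField n M}

include hφ

omit [IsManifold (𝓡 n) ∞ M] in
theorem mdifferentiable_chart' : φ.MDifferentiable (𝓡 n) 𝓘(ℝ, Coord n) :=
  ⟨(contMDiffOn_of_mem_maximalAtlas hφ).mdifferentiableOn (by simp),
    (contMDiffOn_symm_of_mem_maximalAtlas hφ).mdifferentiableOn (by simp)⟩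

omit [IsManifold (𝓡 n) ∞ M] in
theorem chartDeriv_isInvertible {x : M} (hx : x ∈ φ.source) : (chartDeriv φ x).IsInvertible :=
  ⟨(mdifferentiable_chart' hφ).mfderiv hx, rfl⟩

omit [IsManifold (𝓡 n) ∞ M] in
theorem inverse_chartDeriv {x : M} (hx : x ∈ φ.source) (v : TangentSpace (𝓡 n) x) :
    (chartDeriv φ x).inverse (chartDeriv φ x v) = v := by
  obtain ⟨g, hg⟩ := chartDeriv_isInvertible hφ hx
  rw [← hg, ContinuousLinearMap.inverse_equiv]
  exact g.symm_apply_apply v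

omit [IsManifold (𝓡 n) ∞ M] in
theorem chartDeriv_inverse {x : M} (hx : x ∈ φ.source) (v : Coord n) :
    chartDeriv φ x ((chartDeriv φ x).inverse v) = v := by
  obtain ⟨g, hg⟩ := chartDeriv_isInvertible hφ hx
  rw [← hg, ContinuousLinearMap.inverse_equiv]
  exact g.apply_symm_apply v

omit hφ in
theorem pushOp_apply (L : OperatorField n M) {x : M} (hx : x ∈ φ.source) (v : Coord n) :
    pushOp φ L (φ x) v = chartDeriv φ x (L.op x ((chartDeriv φ x).inverse v)) :=
  congrArg (fun z => (chartDeriv φ z (L.op z ((chartDeriv φ z).inverse v)) : Coord n))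
    (φ.left_inv hx)

omit hφ [IsManifold (𝓡 n) ∞ M] in
theorem pushField_apply (X : VField n M) {x : M} (hx : x ∈ φ.source) :
    pushField φ X (φ x) = chartDeriv φ x (X x) :=
  congrArg (fun z => (chartDeriv φ z (X z) : Coord n)) (φ.left_inv hx)

omit [IsManifold (𝓡 n) ∞ M] in
theorem pullField_pushField (X : VField n M) {x : M} (hx : x ∈ φ.source) :
    pullField φ (pushField φ X) x = X x := by
  rw [pullField_apply, pushField_apply X hx, inverse_chartDeriv hφ hx]

theorem op_inverse (L : OperatorField n M) {x : M} (hx : x ∈ φ.source) (v : Coord n) :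
    L.op x ((chartDeriv φ x).inverse v) = (chartDeriv φ x).inverse (pushOp φ L (φ x) v) := by
  rw [pushOp_apply L hx, inverse_chartDeriv hφ hx]

theorem apply_pullField (L : OperatorField n M) (X : Coord n → Coord n) {x : M}
    (hx : x ∈ φ.source) :
    L.apply (pullField φ X) x = pullField φ (fun y => pushOp φ L y (X y)) x :=
  op_inverse hφ L hx _

theorem apply_pullField_eventuallyEq (L : OperatorField n M) (X : Coord n → Coord n) {x : M}
    (hx : x ∈ φ.source) :
    L.apply (pullField φ X) =ᶠ[𝓝 x] pullField φ (fun y => pushOp φ L y (X y)) := by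
  filter_upwards [φ.open_source.mem_nhds hx] with y hy using apply_pullField hφ L X hy

theorem contMDiffAt_pullField {X : Coord n → Coord n} {x : M} (hx : x ∈ φ.source)
    (hX : ContDiffAt ℝ ∞ X (φ x)) :
    ContMDiffAt (𝓡 n) (𝓡 n).tangent ∞
      (fun x => (⟨x, pullField φ X x⟩ : TangentBundle (𝓡 n) M)) x :=
  ContMDiffAt.mpullback_vectorField_preimage (contMDiffAt_vectorSpace_iff_contDiffAt.2 hX)
    (contMDiffAt_of_mem_maximalAtlas hφ hx) (chartDeriv_isInvertible hφ hx) (by simp)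

theorem contDiffAt_pushField {X : VField n M} {y : Coord n} (hy : y ∈ φ.target)
    (hX : ContMDiffAt (𝓡 n) (𝓡 n).tangent ∞
      (fun x => (⟨x, X x⟩ : TangentBundle (𝓡 n) M)) (φ.symm y)) :
    ContDiffAt ℝ ∞ (pushField φ X) y := by
  have h1 : ContMDiffAt 𝓘(ℝ, Coord n) 𝓘(ℝ, Coord n).tangent ∞
      (fun y => (⟨y, VectorField.mpullback 𝓘(ℝ, Coord n) (𝓡 n) φ.symm X y⟩ :
        TangentBundle 𝓘(ℝ, Coord n) (Coord n))) y :=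
    ContMDiffAt.mpullback_vectorField_preimage hX
      (contMDiffAt_symm_of_mem_maximalAtlas hφ hy)
      ⟨(mdifferentiable_chart' hφ).symm.mfderiv hy, rfl⟩ (n := ∞) (by simp)
  refine (contMDiffAt_vectorSpace_iff_contDiffAt.1 h1).congr_of_eventuallyEq ?_
  filter_upwards [φ.open_target.mem_nhds hy] with z hz
  have hinv : (mfderiv 𝓘(ℝ, Coord n) (𝓡 n) φ.symm z).IsInvertible :=
    ⟨(mdifferentiable_chart' hφ).symm.mfderiv hz, rfl⟩
  -- The pullback under `φ.symm` involves the inverse of its differential, which is the differential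
  -- of `φ`; so it coincides with `pushField` on the target.
  refine ((hinv.inverse_apply_eq).2 ?_).symm
  have h2 := (mdifferentiable_chart' hφ).symm_comp_deriv (φ.map_target hz)
  have h3 := DFunLike.congr_fun h2 (X (φ.symm z))
  have h4 := φ.right_inv hz
  exact h3.symm.trans (congrArg (fun w => (mfderiv 𝓘(ℝ, Coord n) (𝓡 n) φ.symm w
    (chartDeriv φ (φ.symm z) (X (φ.symm z))) : Coord n)) h4)

/-- In finite dimension it suffices to test on constant vectors `v`: pull back the constant field,
apply `L`, and push the smooth result forward. -/
theorem contDiffOn_pushOp (L : OperatorField n M) : ContDiffOn ℝ ∞ (pushOp φ L) φ.target := by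
  rw [contDiffOn_clm_apply]
  intro v y hy
  refine ContDiffAt.contDiffWithinAt ?_
  have hx := φ.map_target hy
  have h1 := contMDiffAt_pullField hφ hx (X := fun _ => v) contDiffAt_const
  have h2 := contDiffAt_pushField hφ hy (ContMDiffAt.clm_bundle_apply (L.smooth (φ.symm y)) h1)
  exact h2

theorem mlieBracket_pullField {X Y : Coord n → Coord n} {x : M} (hx : x ∈ φ.source)
    (hX : ContDiffAt ℝ ∞ X (φ x)) (hY : ContDiffAt ℝ ∞ Y (φ x)) :
    VectorField.mlieBracket (𝓡 n) (pullField φ X) (pullField φ Y) x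
      = (chartDeriv φ x).inverse (VectorField.lieBracket ℝ X Y (φ x)) := by
  have : IsManifold (𝓡 n) (minSmoothness ℝ 2) M :=
    IsManifold.of_le (n := ∞) (by simpa using two_le_infty)
  have h1 := VectorField.mpullback_mlieBracket (I := 𝓡 n) (I' := 𝓘(ℝ, Coord n)) (f := φ)
    (V := X) (W := Y) (x₀ := x) (n := ∞)
    ((contMDiffAt_vectorSpace_iff_contDiffAt.2 hX).mdifferentiableAt (by simp))
    ((contMDiffAt_vectorSpace_iff_contDiffAt.2 hY).mdifferentiableAt (by simp))
    (contMDiffAt_of_mem_maximalAtlas hφ hx) (by simpa using two_le_infty)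
  exact h1.symm.trans
    (congrArg (chartDeriv φ x).inverse (mlieBracket_eq_lieBracket X Y (φ x)))

theorem nijenhuisTorsion_pullField {X Y : Coord n → Coord n} {x : M} (hx : x ∈ φ.source)
    (hX : ContDiffAt ℝ ∞ X (φ x)) (hY : ContDiffAt ℝ ∞ Y (φ x)) :
    nijenhuisTorsion L (pullField φ X) (pullField φ Y) x
      = (chartDeriv φ x).inverse (vectorNijenhuis (pushOp φ L) X Y (φ x)) := by
  have hL : ContDiffAt ℝ ∞ (pushOp φ L) (φ x) :=
    (contDiffOn_pushOp hφ L).contDiffAt (φ.open_target.mem_nhds (φ.map_source hx))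
  have hLX : ContDiffAt ℝ ∞ (fun y => pushOp φ L y (X y)) (φ x) := hL.clm_apply hX
  have hLY : ContDiffAt ℝ ∞ (fun y => pushOp φ L y (Y y)) (φ x) := hL.clm_apply hY
  have eX := apply_pullField_eventuallyEq hφ L X hx
  have eY := apply_pullField_eventuallyEq hφ L Y hx
  change L.op x (L.op x (VectorField.mlieBracket (𝓡 n) (pullField φ X) (pullField φ Y) x))
    + VectorField.mlieBracket (𝓡 n) (L.apply (pullField φ X)) (L.apply (pullField φ Y)) x
    - L.op x (VectorField.mlieBracket (𝓡 n) (pullField φ X) (L.apply (pullField φ Y)) x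
        + VectorField.mlieBracket (𝓡 n) (L.apply (pullField φ X)) (pullField φ Y) x) = _
  rw [eX.mlieBracket_vectorField_eq eY, (EventuallyEq.refl (𝓝 x) (pullField φ X)).mlieBracket_vectorField_eq eY,
    eX.mlieBracket_vectorField_eq (EventuallyEq.refl (𝓝 x) (pullField φ Y)), mlieBracket_pullField hφ hx hX hY,
    mlieBracket_pullField hφ hx hLX hLY, mlieBracket_pullField hφ hx hX hLY,
    mlieBracket_pullField hφ hx hLX hY]
  simp only [vectorNijenhuis, map_add, map_sub, op_inverse hφ L hx]

-- Torsions depend only on germs. This matters because `L.apply (pullField φ X)` is known to be a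
-- pulled-back field only inside the chart domain.
omit hφ in
theorem nijenhuisTorsion_congr {X X' Y Y' : VField n M} {x : M} (hX : X =ᶠ[𝓝 x] X')
    (hY : Y =ᶠ[𝓝 x] Y') : nijenhuisTorsion L X Y x = nijenhuisTorsion L X' Y' x := by
  have eX : L.apply X =ᶠ[𝓝 x] L.apply X' := by
    filter_upwards [hX] with y hy
    exact congrArg (L.op y) hy
  have eY : L.apply Y =ᶠ[𝓝 x] L.apply Y' := by
    filter_upwards [hY] with y hy
    exact congrArg (L.op y) hy
  change L.op x (L.op x (VectorField.mlieBracket (𝓡 n) X Y x))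
    + VectorField.mlieBracket (𝓡 n) (L.apply X) (L.apply Y) x
    - L.op x (VectorField.mlieBracket (𝓡 n) X (L.apply Y) x
        + VectorField.mlieBracket (𝓡 n) (L.apply X) Y x) = _
  rw [hX.mlieBracket_vectorField_eq hY, eX.mlieBracket_vectorField_eq eY,
    hX.mlieBracket_vectorField_eq eY, eX.mlieBracket_vectorField_eq hY]
  rfl

omit hφ in
theorem haantjesTorsion_congr {X X' Y Y' : VField n M} {x : M} (hX : X =ᶠ[𝓝 x] X')
    (hY : Y =ᶠ[𝓝 x] Y') : haantjesTorsion L X Y x = haantjesTorsion L X' Y' x := by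
  have eX : L.apply X =ᶠ[𝓝 x] L.apply X' := by
    filter_upwards [hX] with y hy
    exact congrArg (L.op y) hy
  have eY : L.apply Y =ᶠ[𝓝 x] L.apply Y' := by
    filter_upwards [hY] with y hy
    exact congrArg (L.op y) hy
  change L.op x (L.op x (nijenhuisTorsion L X Y x))
    + nijenhuisTorsion L (L.apply X) (L.apply Y) x
    - L.op x (nijenhuisTorsion L X (L.apply Y) x + nijenhuisTorsion L (L.apply X) Y x) = _
  rw [nijenhuisTorsion_congr hX hY, nijenhuisTorsion_congr eX eY, nijenhuisTorsion_congr hX eY,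
    nijenhuisTorsion_congr eX hY]
  rfl

theorem haantjesTorsion_pullField {X Y : Coord n → Coord n} {x : M} (hx : x ∈ φ.source)
    (hX : ContDiffAt ℝ ∞ X (φ x)) (hY : ContDiffAt ℝ ∞ Y (φ x)) :
    haantjesTorsion L (pullField φ X) (pullField φ Y) x
      = (chartDeriv φ x).inverse (vectorHaantjes (pushOp φ L) X Y (φ x)) := by
  have hL : ContDiffAt ℝ ∞ (pushOp φ L) (φ x) :=
    (contDiffOn_pushOp hφ L).contDiffAt (φ.open_target.mem_nhds (φ.map_source hx))
  have hLX : ContDiffAt ℝ ∞ (fun y => pushOp φ L y (X y)) (φ x) := hL.clm_apply hX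
  have hLY : ContDiffAt ℝ ∞ (fun y => pushOp φ L y (Y y)) (φ x) := hL.clm_apply hY
  have eX := apply_pullField_eventuallyEq hφ L X hx
  have eY := apply_pullField_eventuallyEq hφ L Y hx
  change L.op x (L.op x (nijenhuisTorsion L (pullField φ X) (pullField φ Y) x))
    + nijenhuisTorsion L (L.apply (pullField φ X)) (L.apply (pullField φ Y)) x
    - L.op x (nijenhuisTorsion L (pullField φ X) (L.apply (pullField φ Y)) x
        + nijenhuisTorsion L (L.apply (pullField φ X)) (pullField φ Y) x) = _
  rw [nijenhuisTorsion_congr eX eY, nijenhuisTorsion_congr (EventuallyEq.refl (𝓝 x) (pullField φ X)) eY,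
    nijenhuisTorsion_congr eX (EventuallyEq.refl (𝓝 x) (pullField φ Y)), nijenhuisTorsion_pullField hφ hx hX hY,
    nijenhuisTorsion_pullField hφ hx hLX hLY, nijenhuisTorsion_pullField hφ hx hX hLY,
    nijenhuisTorsion_pullField hφ hx hLX hY]
  simp only [vectorHaantjes, map_add, map_sub, op_inverse hφ L hx]

/-- Vanishing of the Haantjes torsion, read in a chart. -/
theorem IsHaantjes.vectorHaantjes_eq_zero (hL : IsHaantjes L) {Ω : Set (Coord n)}
    (hΩ : IsOpen Ω) (hΩφ : Ω ⊆ φ.target) {X Y : Coord n → Coord n} (hX : ContDiffOn ℝ ∞ X Ω)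
    (hY : ContDiffOn ℝ ∞ Y Ω) {y : Coord n} (hy : y ∈ Ω) :
    vectorHaantjes (pushOp φ L) X Y y = 0 := by
  have hs : ∀ {Z : Coord n → Coord n}, ContDiffOn ℝ ∞ Z Ω →
      SmoothOn (pullField φ Z) (φ.source ∩ φ ⁻¹' Ω) := fun hZ x hx =>
    (contMDiffAt_pullField hφ hx.1 (hZ.contDiffAt (hΩ.mem_nhds hx.2))).contMDiffWithinAt
  have hx := φ.map_target (hΩφ hy)
  have hxy := φ.right_inv (hΩφ hy)
  have h1 := hL _ _ _ (φ.isOpen_inter_preimage hΩ) (hs hX) (hs hY) (φ.symm y)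
    ⟨hx, by rw [mem_preimage, hxy]; exact hy⟩
  rw [haantjesTorsion_pullField hφ hx (by rw [hxy]; exact hX.contDiffAt (hΩ.mem_nhds hy))
    (by rw [hxy]; exact hY.contDiffAt (hΩ.mem_nhds hy))] at h1
  have h2 := congrArg (chartDeriv φ (φ.symm y)) h1
  rw [chartDeriv_inverse hφ hx, map_zero, hxy] at h2
  exact h2

/-- The Haantjes torsion of smooth fields vanishes at a point where it does in a chart. -/
theorem haantjesTorsion_eq_zero_of_chart {U : Set M} (hU : IsOpen U) {X Y : VField n M}
    (hX : SmoothOn X U) (hY : SmoothOn Y U) {x : M} (hxU : x ∈ U) (hx : x ∈ φ.source)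
    (h : ∀ X Y : Coord n → Coord n, ContDiffAt ℝ ∞ X (φ x) → ContDiffAt ℝ ∞ Y (φ x) →
      vectorHaantjes (pushOp φ L) X Y (φ x) = 0) : haantjesTorsion L X Y x = 0 := by
  have hs : ∀ {Z : VField n M}, SmoothOn Z U → ContDiffAt ℝ ∞ (pushField φ Z) (φ x) := fun hZ =>
    contDiffAt_pushField hφ (φ.map_source hx)
      (by rw [φ.left_inv hx]; exact hZ.contMDiffAt (hU.mem_nhds hxU))
  have he : ∀ Z : VField n M, Z =ᶠ[𝓝 x] pullField φ (pushField φ Z) := fun Z => by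
    filter_upwards [φ.open_source.mem_nhds hx] with z hz
    exact (pullField_pushField hφ Z hz).symm
  rw [haantjesTorsion_congr (he X) (he Y), haantjesTorsion_pullField hφ hx (hs hX) (hs hY),
    h _ _ (hs hX) (hs hY), map_zero]

end Transfer

/-! ### Spectral data under conjugation -/

section Conjugation

variable {V W : Type*} [AddCommGroup V] [Module ℝ V] [AddCommGroup W] [Module ℝ W]

theorem mem_maxGenEigenspace_conj (g : V ≃ₗ[ℝ] W) (T : Module.End ℝ V) (μ : ℝ) (v : V) :
    g v ∈ Module.End.maxGenEigenspace (g.conjAlgEquiv ℝ T) μ ↔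
      v ∈ Module.End.maxGenEigenspace T μ := by
  simp only [Module.End.mem_maxGenEigenspace]
  refine exists_congr fun k => ?_
  have h1 : (g.conjAlgEquiv ℝ T - μ • 1) ^ k = g.conjAlgEquiv ℝ ((T - μ • 1) ^ k) := by
    rw [map_pow, map_sub, map_smul, map_one]
  rw [h1, LinearEquiv.conjAlgEquiv_apply]
  simp

theorem maxGenEigenspace_conj (g : V ≃ₗ[ℝ] W) (T : Module.End ℝ V) (μ : ℝ) :
    Module.End.maxGenEigenspace (g.conjAlgEquiv ℝ T) μ =
      (Module.End.maxGenEigenspace T μ).map (g : V →ₗ[ℝ] W) := by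
  ext w
  obtain ⟨v, rfl⟩ := g.surjective w
  rw [mem_maxGenEigenspace_conj, Submodule.mem_map]
  exact ⟨fun h => ⟨v, h, rfl⟩, fun ⟨u, hu, huv⟩ => g.injective huv ▸ hu⟩

theorem hasEigenvalue_conj (g : V ≃ₗ[ℝ] W) (T : Module.End ℝ V) (μ : ℝ) :
    Module.End.HasEigenvalue (g.conjAlgEquiv ℝ T) μ ↔ Module.End.HasEigenvalue T μ := by
  constructor
  · intro h
    obtain ⟨w, hw, hw0⟩ := h.exists_hasEigenvector
    refine Module.End.hasEigenvalue_of_hasEigenvector (x := g.symm w)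
      ⟨Module.End.mem_eigenspace_iff.2 (g.injective ?_), by simpa using hw0⟩
    have h1 := Module.End.mem_eigenspace_iff.1 hw
    rw [LinearEquiv.conjAlgEquiv_apply] at h1
    simpa using h1
  · intro h
    obtain ⟨v, hv, hv0⟩ := h.exists_hasEigenvector
    refine Module.End.hasEigenvalue_of_hasEigenvector (x := g v)
      ⟨Module.End.mem_eigenspace_iff.2 ?_, by simpa using hv0⟩
    have h1 := Module.End.mem_eigenspace_iff.1 hv
    rw [LinearEquiv.conjAlgEquiv_apply]
    simp [h1]

end Conjugation

/-! ### Adapted charts on the manifold -/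

section AdaptedChart

variable {n : ℕ} {M : Type*} [TopologicalSpace M] [ChartedSpace (Coord n) M]
  [IsManifold (𝓡 n) ∞ M] {φ : OpenPartialHomeomorph M (Coord n)}
  (hφ : φ ∈ IsManifold.maximalAtlas (𝓡 n) ∞ M) {L : OperatorField n M}

include hφ

/-- In a chart, an operator field is conjugate to its coordinate expression. -/
theorem exists_conj_pushOp (L : OperatorField n M) {x : M} (hx : x ∈ φ.source) :
    ∃ g : TangentSpace (𝓡 n) x ≃ₗ[ℝ] Coord n, (∀ v, g v = chartDeriv φ x v) ∧
      (pushOp φ L (φ x) : Module.End ℝ (Coord n)) = g.conjAlgEquiv ℝ (L.endAt x) := by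
  obtain ⟨g, hg⟩ := chartDeriv_isInvertible hφ hx
  refine ⟨g.toLinearEquiv, fun v => congrArg (fun T => T v) hg, LinearMap.ext fun v => ?_⟩
  refine (pushOp_apply L hx v).trans ?_
  rw [← hg, ContinuousLinearMap.inverse_equiv]
  rfl

theorem mem_maxGenEigenspace_pushOp (L : OperatorField n M) {x : M} (hx : x ∈ φ.source) (μ : ℝ)
    (v : TangentSpace (𝓡 n) x) :
    chartDeriv φ x v ∈ Module.End.maxGenEigenspace (pushOp φ L (φ x) : Module.End ℝ (Coord n)) μ ↔
      v ∈ genEigenspace L x μ := by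
  obtain ⟨g, hg, hgL⟩ := exists_conj_pushOp hφ L hx
  rw [hgL, ← hg, mem_maxGenEigenspace_conj]
  rfl

/-- Spectral data of an operator field, read in a chart. -/
theorem hasSpectrumOn_pushOp {s : ℕ} {l : Fin s → M → ℝ} (hl_cont : ∀ i, Continuous (l i))
    (hl_inj : ∀ x, Function.Injective fun i => l i x)
    (h_real : ∀ x, (minpoly ℝ (L.endAt x)).Splits)
    (hl_spec : ∀ x μ, Module.End.HasEigenvalue (L.endAt x) μ ↔ ∃ i, l i x = μ)
    {r : Fin s → ℕ} (h_rank : ∀ i x, Module.finrank ℝ (genEigenspace L x (l i x)) = r i) :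
    HasSpectrumOn (pushOp φ L) (fun i y => l i (φ.symm y)) r φ.target where
  smooth := contDiffOn_pushOp hφ L
  continuousOn i := (hl_cont i).comp_continuousOn φ.symm.continuousOn
  injective y _ := hl_inj (φ.symm y)
  splits y hy := by
    obtain ⟨g, -, hgL⟩ := exists_conj_pushOp hφ L (φ.map_target hy)
    rw [φ.right_inv hy] at hgL
    rw [hgL, minpoly.algEquiv_eq]
    exact h_real _
  hasEigenvalue_iff y hy μ := by
    obtain ⟨g, -, hgL⟩ := exists_conj_pushOp hφ L (φ.map_target hy)
    rw [φ.right_inv hy] at hgL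
    rw [hgL, hasEigenvalue_conj]
    exact hl_spec _ μ
  finrank_eq i y hy := by
    obtain ⟨g, -, hgL⟩ := exists_conj_pushOp hφ L (φ.map_target hy)
    rw [φ.right_inv hy] at hgL
    rw [hgL, maxGenEigenspace_conj, LinearEquiv.finrank_map_eq]
    exact h_rank i _

theorem trans_mem_maximalAtlas {e : OpenPartialHomeomorph (Coord n) (Coord n)}
    (he : ContDiffOn ℝ ∞ e e.source) (he' : ContDiffOn ℝ ∞ e.symm e.target) :
    φ ≫ₕ e ∈ IsManifold.maximalAtlas (𝓡 n) ∞ M := by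
  refine OpenPartialHomeomorph.mem_maximalAtlas_of_contMDiffOn _ ?_ ?_
  · exact he.contMDiffOn.comp ((contMDiffOn_of_mem_maximalAtlas hφ).mono fun x hx => hx.1)
      fun x hx => hx.2
  · exact (contMDiffOn_symm_of_mem_maximalAtlas hφ).comp
      (he'.contMDiffOn.mono fun x hx => hx.1) fun x hx => hx.2

omit [IsManifold (𝓡 n) ∞ M] in
theorem chartDeriv_trans {e : OpenPartialHomeomorph (Coord n) (Coord n)}
    (he : ContDiffOn ℝ ∞ e e.source) {x : M} (hx : x ∈ (φ ≫ₕ e).source)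
    (v : TangentSpace (𝓡 n) x) :
    chartDeriv (φ ≫ₕ e) x v = fderiv ℝ e (φ x) (chartDeriv φ x v) := by
  have h1 : MDifferentiableAt 𝓘(ℝ, Coord n) 𝓘(ℝ, Coord n) e (φ x) :=
    ((he.contDiffAt (e.open_source.mem_nhds hx.2)).differentiableAt (by simp)).mdifferentiableAt
  have h2 := mfderiv_comp x h1 ((mdifferentiable_chart' hφ).mdifferentiableAt hx.1)
  rw [mfderiv_eq_fderiv] at h2
  exact congrArg (fun T => (T v : Coord n)) h2

omit hφ in
/-- Around each point there is a chart adapted to the generalized eigen-distributions of an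
operator field with vanishing Haantjes torsion. -/
theorem exists_adapted_chart {s : ℕ} {l : Fin s → M → ℝ} (hl_cont : ∀ i, Continuous (l i))
    (hl_inj : ∀ x, Function.Injective fun i => l i x)
    (h_real : ∀ x, (minpoly ℝ (L.endAt x)).Splits)
    (hl_spec : ∀ x μ, Module.End.HasEigenvalue (L.endAt x) μ ↔ ∃ i, l i x = μ)
    {r : Fin s → ℕ} (h_rank : ∀ i x, Module.finrank ℝ (genEigenspace L x (l i x)) = r i)
    (hL : IsHaantjes L) (x₀ : M) :
    ∃ (φ : OpenPartialHomeomorph M (Coord n)) (p : Fin n → Fin s), IsChartAt φ x₀ ∧ Monotone p ∧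
      ∀ x ∈ φ.source, ∀ i v, v ∈ genEigenspace L x (l i x) ↔
        ∀ k, p k ≠ i → chartDeriv φ x v k = 0 := by
  have hφ : chartAt (Coord n) x₀ ∈ IsManifold.maximalAtlas (𝓡 n) ∞ M :=
    IsManifold.chart_mem_maximalAtlas x₀
  set φ := chartAt (Coord n) x₀
  have hx₀ : x₀ ∈ φ.source := mem_chart_source _ x₀
  have hspec := hasSpectrumOn_pushOp hφ hl_cont hl_inj h_real hl_spec h_rank
  obtain ⟨e, p, hp, hxe, heφ, he, he', hadapted⟩ := exists_adapted_coordinates hspec φ.open_target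
    (fun Ω hΩφ hΩ X Y hX hY y hy => hL.vectorHaantjes_eq_zero hφ hΩ hΩφ hX hY hy)
    (φ.map_source hx₀)
  refine ⟨φ ≫ₕ e, p, ⟨trans_mem_maximalAtlas hφ he he', ⟨hx₀, hxe⟩⟩, hp, fun x hx i v => ?_⟩
  rw [← mem_maxGenEigenspace_pushOp hφ L hx.1]
  have h1 := hadapted (φ x) hx.2 i (chartDeriv φ x v)
  rw [φ.left_inv hx.1] at h1
  rw [h1]
  exact forall_congr' fun k => imp_congr_right fun _ => by rw [chartDeriv_trans hφ he hx]

end AdaptedChart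

theorem pow_sub_smul_apply {V : Type*} [AddCommGroup V] [Module ℝ V] {T : Module.End ℝ V}
    {v : V} {a : ℝ} (h : T v = a • v) (μ : ℝ) (m : ℕ) :
    ((T - μ • 1) ^ m) v = (a - μ) ^ m • v := by
  induction m with
  | zero => simp
  | succ m ih =>
    rw [pow_succ', Module.End.mul_apply, ih, map_smul, LinearMap.sub_apply, h,
      LinearMap.smul_apply, Module.End.one_apply, ← sub_smul, smul_smul, pow_succ]

/-- Generalized eigenvectors of a diagonalizable endomorphism are eigenvectors. -/
theorem apply_eq_smul_of_mem_maxGenEigenspace {V ι : Type*} [AddCommGroup V] [Module ℝ V]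
    [Fintype ι] {T : Module.End ℝ V} {Y : ι → V} (hli : LinearIndependent ℝ Y)
    (hsp : Submodule.span ℝ (range Y) = ⊤) {a : ι → ℝ} (hY : ∀ k, T (Y k) = a k • Y k)
    {v : V} {μ : ℝ} (hv : v ∈ Module.End.maxGenEigenspace T μ) : T v = μ • v := by
  obtain ⟨m, hm⟩ := (Module.End.mem_maxGenEigenspace _ _ _).1 hv
  set b := Module.Basis.mk hli hsp.ge
  have hb : ∀ k, b k = Y k := fun k => Module.Basis.mk_apply hli hsp.ge k
  have hsum : v = ∑ k, b.repr v k • Y k := by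
    conv_lhs => rw [← b.sum_repr v]
    simp only [hb]
  generalize b.repr v = c at hsum
  subst hsum
  rw [map_sum] at hm
  simp only [map_smul, pow_sub_smul_apply (hY _), smul_smul] at hm
  -- For every `k`, the coefficient times `(a k - μ) ^ m` vanishes: only eigenvectors with
  -- eigenvalue exactly `μ` contribute to `v`.
  have h0 := Fintype.linearIndependent_iff.1 hli _ hm
  rw [map_sum, Finset.smul_sum]
  refine Finset.sum_congr rfl fun k _ => ?_
  rw [map_smul, hY, smul_smul, smul_smul]
  rcases mul_eq_zero.1 (h0 k) with h | h
  · simp [h]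
  · rw [sub_eq_zero.1 (eq_zero_of_pow_eq_zero h), mul_comm]

/-! ### Frames equivalent to a natural frame, and the form of the operator in them -/

section NaturalFrame

variable {n : ℕ} {M : Type*} [TopologicalSpace M] [ChartedSpace (Coord n) M]
  [IsManifold (𝓡 n) ∞ M] {φ : OpenPartialHomeomorph M (Coord n)} {L : OperatorField n M}

theorem IsSemisimpleField.apply_eq_smul (hL : IsSemisimpleField L) {x : M} {μ : ℝ}
    {v : TangentSpace (𝓡 n) x} (hv : v ∈ genEigenspace L x μ) : L.op x v = μ • v := by
  obtain ⟨U, Y, hx, hY, hE⟩ := hL x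
  choose a ha using hE x hx
  exact apply_eq_smul_of_mem_maxGenEigenspace (hY.linearIndependent x hx) (hY.span_eq_top x hx)
    (fun k => (ha k).apply_eq_smul) hv

section

variable (hφ : φ ∈ IsManifold.maximalAtlas (𝓡 n) ∞ M)
include hφ

omit [IsManifold (𝓡 n) ∞ M] in
theorem chartDeriv_naturalFrame {x : M} (hx : x ∈ φ.source) (k : Fin n) :
    chartDeriv φ x (naturalFrame φ k x) = EuclideanSpace.single k 1 := by
  rw [naturalFrame_apply, chartDeriv_inverse hφ hx]

omit [IsManifold (𝓡 n) ∞ M] in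
theorem sum_chartDeriv_smul_naturalFrame {x : M} (hx : x ∈ φ.source) (v : TangentSpace (𝓡 n) x) :
    ∑ k, chartDeriv φ x v k • naturalFrame φ k x = v := by
  have h1 : chartDeriv φ x v = ∑ k, chartDeriv φ x v k • EuclideanSpace.single k (1 : ℝ) := by
    ext j
    simp [Finset.sum_apply, Pi.single_apply]
  conv_rhs => rw [← inverse_chartDeriv hφ hx v, h1, map_sum]
  exact Finset.sum_congr rfl fun k _ => (map_smul _ _ _).symm

theorem smoothOn_naturalFrame (k : Fin n) : SmoothOn (naturalFrame φ k) φ.source := fun _ hx =>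
  (contMDiffAt_pullField hφ hx (X := fun _ => EuclideanSpace.single k (1 : ℝ))
    contDiffAt_const).contMDiffWithinAt

omit [IsManifold (𝓡 n) ∞ M] in
/-- Expansion of a tangent vector in a frame proportional to the natural one. -/
theorem sum_div_smul_eq {Y : Fin n → VField n M} {f : Fin n → M → ℝ} {x : M} (hx : x ∈ φ.source)
    (hY : ∀ k, f k x ≠ 0 ∧ Y k x = f k x • naturalFrame φ k x) (v : TangentSpace (𝓡 n) x) :
    ∑ k, (chartDeriv φ x v k / f k x) • Y k x = v := by
  conv_rhs => rw [← sum_chartDeriv_smul_naturalFrame hφ hx v]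
  refine Finset.sum_congr rfl fun k _ => ?_
  rw [(hY k).2, smul_smul, div_mul_cancel₀ _ (hY k).1]

omit [IsManifold (𝓡 n) ∞ M] in
theorem chartDeriv_equivFrame {Y : Fin n → VField n M} {f : Fin n → M → ℝ} {x : M}
    (hx : x ∈ φ.source) (hY : ∀ k, f k x ≠ 0 ∧ Y k x = f k x • naturalFrame φ k x) (j k : Fin n) :
    chartDeriv φ x (Y k x) j = if j = k then f k x else 0 := by
  rw [(hY k).2, map_smul, chartDeriv_naturalFrame hφ hx]
  simp

theorem EquivFrames.isFrame {Y : Fin n → VField n M}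
    (hY : EquivFrames Y (naturalFrame φ) φ.source) : IsFrame Y φ.source := by
  obtain ⟨f, hf, hfY⟩ := hY
  refine ⟨φ.open_source, fun k => ?_, fun x hx => ?_, fun x hx => ?_⟩
  · have h1 := (hf k).smul_section (smoothOn_naturalFrame hφ k)
    exact h1.congr fun x hx => by rw [(hfY k x hx).2]; rfl
  · rw [Fintype.linearIndependent_iff]
    intro c hc j
    have h1 := congrArg (fun v => chartDeriv φ x v j) hc
    simp only [map_sum, map_smul, map_zero] at h1
    simp [Finset.sum_apply, chartDeriv_equivFrame hφ hx fun k => hfY k x hx] at h1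
    exact h1.resolve_right (hfY j x hx).1
  · refine eq_top_iff.2 fun v _ => ?_
    rw [← sum_div_smul_eq hφ hx (fun k => hfY k x hx) v]
    exact Submodule.sum_mem _ fun k _ =>
      Submodule.smul_mem _ _ (Submodule.subset_span (mem_range_self k))

omit hφ [IsManifold (𝓡 n) ∞ M] in
theorem EquivFrames.refl (X : Fin n → VField n M) (U : Set M) : EquivFrames X X U :=
  ⟨fun _ _ => 1, fun _ => contMDiffOn_const, fun _ _ _ => ⟨one_ne_zero, (one_smul ℝ _).symm⟩⟩

theorem isFrame_naturalFrame : IsFrame (naturalFrame φ) φ.source :=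
  (EquivFrames.refl _ _).isFrame hφ

theorem EquivFrames.isIntegrableFrame {Y : Fin n → VField n M}
    (hY : EquivFrames Y (naturalFrame φ) φ.source) : IsIntegrableFrame Y φ.source :=
  ⟨hY.isFrame hφ, fun _ hx => ⟨φ, ⟨hφ, hx⟩, Subset.rfl, hY⟩⟩

theorem EquivFrames.isMatrixIn {Y : Fin n → VField n M} {f : Fin n → M → ℝ}
    (hY : ∀ k, ∀ x ∈ φ.source, f k x ≠ 0 ∧ Y k x = f k x • naturalFrame φ k x) :
    IsMatrixIn L Y φ.source
      (fun x => Matrix.of fun j k => chartDeriv φ x (L.op x (Y k x)) j / f j x) := fun x hx _ =>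
  (sum_div_smul_eq hφ hx (fun k => hY k x hx) _).symm

end

section Adapted

variable (hφ : φ ∈ IsManifold.maximalAtlas (𝓡 n) ∞ M) {s : ℕ} {l : Fin s → M → ℝ}
  {p : Fin n → Fin s}
  (hadapt : ∀ x ∈ φ.source, ∀ i v, v ∈ genEigenspace L x (l i x) ↔
    ∀ k, p k ≠ i → chartDeriv φ x v k = 0)
  {Y : Fin n → VField n M} (hY : EquivFrames Y (naturalFrame φ) φ.source)

include hφ hadapt hY

theorem EquivFrames.mem_genEigenspace {x : M} (hx : x ∈ φ.source) (k : Fin n) :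
    Y k x ∈ genEigenspace L x (l (p k) x) := by
  obtain ⟨f, -, hfY⟩ := hY
  refine (hadapt x hx _ _).2 fun j hj => ?_
  rw [chartDeriv_equivFrame hφ hx fun k => hfY k x hx, if_neg]
  rintro rfl
  exact hj rfl

theorem EquivFrames.isGenEigenFrame : IsGenEigenFrame L Y φ.source :=
  ⟨hY.isFrame hφ, fun _ hx k => ⟨_, hY.mem_genEigenspace hφ hadapt hx k⟩⟩

theorem EquivFrames.span_eq_genEigenspace {x : M} (hx : x ∈ φ.source) (i : Fin s) :
    Submodule.span ℝ ((fun k => Y k x) '' {k | p k = i}) = genEigenspace L x (l i x) := by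
  refine le_antisymm (Submodule.span_le.2 ?_) fun v hv => ?_
  · rintro _ ⟨k, rfl, rfl⟩
    exact hY.mem_genEigenspace hφ hadapt hx k
  · obtain ⟨f, -, hfY⟩ := hY
    rw [← sum_div_smul_eq hφ hx (fun k => hfY k x hx) v]
    refine Submodule.sum_mem _ fun k _ => ?_
    by_cases hk : p k = i
    · exact Submodule.smul_mem _ _ (Submodule.subset_span ⟨k, hk, rfl⟩)
    · rw [(hadapt x hx i v).1 hv k hk, zero_div, zero_smul]
      exact Submodule.zero_mem _

theorem EquivFrames.isBlockDiagonalIn : IsBlockDiagonalIn L Y φ.source p := by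
  have hmem := fun x (hx : x ∈ φ.source) k => hY.mem_genEigenspace hφ hadapt hx k
  obtain ⟨f, -, hfY⟩ := hY
  refine ⟨_, EquivFrames.isMatrixIn hφ hfY, fun x hx j k hjk => ?_⟩
  have h1 : L.op x (Y k x) ∈ genEigenspace L x (l (p k) x) :=
    Module.End.mapsTo_maxGenEigenspace_of_comm (Commute.refl (L.endAt x)) _ (hmem x hx k)
  rw [Matrix.of_apply, (hadapt x hx _ _).1 h1 j hjk, zero_div]

theorem EquivFrames.isDiagonalIn (hL : IsSemisimpleField L) : IsDiagonalIn L Y φ.source := by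
  have hmem := fun x (hx : x ∈ φ.source) k => hY.mem_genEigenspace hφ hadapt hx k
  obtain ⟨f, -, hfY⟩ := hY
  refine ⟨_, EquivFrames.isMatrixIn hφ hfY, fun x hx j k hjk => ?_⟩
  change chartDeriv φ x (L.op x (Y k x)) j / f j x = 0
  rw [hL.apply_eq_smul (hmem x hx k), map_smul, PiLp.smul_apply,
    chartDeriv_equivFrame hφ hx fun k => hfY k x hx, if_neg hjk, smul_zero, zero_div]

end Adapted

end NaturalFrame

/-! ### Vanishing of the Haantjes torsion for diagonal operators -/

section DiagonalTorsion

/-- All derivatives of `X` and `Y` cancel, leaving only first derivatives of `L`. This tensorial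
form can be substituted again inside the Haantjes torsion without second derivatives. -/
theorem vectorNijenhuis_apply {E : Type} [NormedAddCommGroup E] [NormedSpace ℝ E]
    {L : E → E →L[ℝ] E} {X Y : E → E} {x : E} (hL : DifferentiableAt ℝ L x)
    (hX : DifferentiableAt ℝ X x) (hY : DifferentiableAt ℝ Y x) :
    vectorNijenhuis L X Y x = fderiv ℝ L x (L x (X x)) (Y x) - fderiv ℝ L x (L x (Y x)) (X x)
      - L x (fderiv ℝ L x (X x) (Y x)) + L x (fderiv ℝ L x (Y x) (X x)) := by
  simp only [vectorNijenhuis, VectorField.lieBracket, fderiv_clm_apply hL hX,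
    fderiv_clm_apply hL hY, add_apply, ContinuousLinearMap.comp_apply,
    ContinuousLinearMap.flip_apply, map_add, map_sub]
  abel

variable {n : ℕ}

/-- The derivative of a field of diagonal operators is diagonal. -/
theorem fderiv_diagonal_apply {L : Coord n → Coord n →L[ℝ] Coord n} {x : Coord n}
    (hL : DifferentiableAt ℝ L x)
    (hd : ∀ᶠ z in 𝓝 x, ∀ b j, L z b j = L z (EuclideanSpace.single j 1) j * b j)
    (v b : Coord n) (j : Fin n) :
    fderiv ℝ L x v b j = fderiv ℝ L x v (EuclideanSpace.single j 1) j * b j := by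
  have h1 : ∀ b : Coord n, HasFDerivAt (fun z => L z b j)
      ((EuclideanSpace.proj j : Coord n →L[ℝ] ℝ) ∘L (fderiv ℝ L x).flip b) x := fun b =>
    (EuclideanSpace.proj j : Coord n →L[ℝ] ℝ).hasFDerivAt.comp x
      ((hL.hasFDerivAt.clm_apply (hasFDerivAt_const b x)).congr_fderiv (by simp))
  have h2 := (h1 (EuclideanSpace.single j 1)).mul_const (b j)
  have h3 := (h1 b).unique (h2.congr_of_eventuallyEq (hd.mono fun z hz => hz b j))
  have h4 := congrArg (fun T => T v) h3
  simpa [mul_comm] using h4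

/-- The Haantjes torsion of a field of diagonal operators vanishes. -/
theorem vectorHaantjes_eq_zero_of_diagonal {L : Coord n → Coord n →L[ℝ] Coord n}
    {X Y : Coord n → Coord n} {x : Coord n} (hL : DifferentiableAt ℝ L x)
    (hd : ∀ᶠ z in 𝓝 x, ∀ b j, L z b j = L z (EuclideanSpace.single j 1) j * b j)
    (hX : DifferentiableAt ℝ X x) (hY : DifferentiableAt ℝ Y x) :
    vectorHaantjes L X Y x = 0 := by
  have hLX : DifferentiableAt ℝ (fun y => L y (X y)) x := hL.clm_apply hX
  have hLY : DifferentiableAt ℝ (fun y => L y (Y y)) x := hL.clm_apply hY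
  ext j
  obtain ⟨c, hc⟩ : ∃ c : ℝ, ∀ b, L x b j = c * b j := ⟨_, fun b => hd.self_of_nhds b j⟩
  obtain ⟨D, hD⟩ : ∃ D : Coord n → ℝ, ∀ v b, fderiv ℝ L x v b j = D v * b j :=
    ⟨_, fun v b => fderiv_diagonal_apply hL hd v b j⟩
  simp only [vectorHaantjes, vectorNijenhuis_apply hL hX hY, vectorNijenhuis_apply hL hLX hLY,
    vectorNijenhuis_apply hL hX hLY, vectorNijenhuis_apply hL hLX hY, PiLp.add_apply,
    PiLp.sub_apply, PiLp.zero_apply, hc, hD]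
  -- In the `j`-th component of the Nijenhuis torsion every term contains `X` only through `X j` or
  -- `Y` only through `Y j`, where `L` acts as the scalar `c`. The further defects in both arguments
  -- therefore cancel all terms.
  ring

end DiagonalTorsion

/-! ### Diagonal charts imply vanishing Haantjes torsion -/

section DiagonalCharts

variable {n : ℕ} {M : Type*} [TopologicalSpace M] [ChartedSpace (Coord n) M]
  [IsManifold (𝓡 n) ∞ M] {φ : OpenPartialHomeomorph M (Coord n)} {L : OperatorField n M}

theorem pushOp_apply_eq_mul (hφ : φ ∈ IsManifold.maximalAtlas (𝓡 n) ∞ M) {x : M}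
    (hx : x ∈ φ.source)
    (h : ∀ k, ∃ a : ℝ, L.op x (naturalFrame φ k x) = a • naturalFrame φ k x) (b : Coord n)
    (j : Fin n) :
    pushOp φ L (φ x) b j = pushOp φ L (φ x) (EuclideanSpace.single j 1) j * b j := by
  choose a ha using h
  have h1 : ∀ k, pushOp φ L (φ x) (EuclideanSpace.single k 1)
      = a k • EuclideanSpace.single k (1 : ℝ) := fun k => by
    rw [pushOp_apply L hx, ← naturalFrame_apply, ha, map_smul, chartDeriv_naturalFrame hφ hx]
  have h2 : b = ∑ k, b k • EuclideanSpace.single k (1 : ℝ) := by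
    ext j
    simp [Finset.sum_apply, Pi.single_apply]
  conv_lhs => rw [h2, map_sum]
  simp [h1, Finset.sum_apply, Pi.single_apply, mul_comm]

theorem isHaantjes_of_exists_chart (h : ∀ x₀ : M, ∃ φ : OpenPartialHomeomorph M (Coord n),
    IsChartAt φ x₀ ∧ ∀ x ∈ φ.source, ∀ k, ∃ a : ℝ,
      L.op x (naturalFrame φ k x) = a • naturalFrame φ k x) : IsHaantjes L := by
  intro U X Y hU hX hY x hxU
  obtain ⟨φ, ⟨hφ, hx⟩, hd⟩ := h x
  refine haantjesTorsion_eq_zero_of_chart hφ hU hX hY hxU hx fun X Y hX hY => ?_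
  refine vectorHaantjes_eq_zero_of_diagonal
    (((contDiffOn_pushOp hφ L).contDiffAt (φ.open_target.mem_nhds (φ.map_source hx))
      ).differentiableAt (by simp)) ?_ (hX.differentiableAt (by simp))
    (hY.differentiableAt (by simp))
  filter_upwards [φ.open_target.mem_nhds (φ.map_source hx)] with z hz b j
  have h1 := pushOp_apply_eq_mul hφ (φ.map_target hz) (hd _ (φ.map_target hz)) b j
  rwa [φ.right_inv hz] at h1

theorem IsDiagonalIn.exists_apply_eq_smul {Y : Fin n → VField n M}
    {U : Set M} (h : IsDiagonalIn L Y U) {x : M} (hx : x ∈ U) (k : Fin n) :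
    ∃ a : ℝ, L.op x (Y k x) = a • Y k x := by
  obtain ⟨A, hA, hd⟩ := h
  refine ⟨A x k k, ?_⟩
  rw [hA x hx k, Finset.sum_eq_single k (fun j _ hj => by rw [hd x hx hj, zero_smul])
    fun h => absurd (Finset.mem_univ k) h]

/-- A semisimple operator field with integrable generalized eigen-frames has vanishing Haantjes
torsion. -/
theorem IsSemisimpleField.isHaantjes (hL : IsSemisimpleField L)
    (h : ∀ x₀ : M, ∃ (U : Set M) (Y : Fin n → VField n M), x₀ ∈ U ∧
      IsIntegrableFrame Y U ∧ IsGenEigenFrame L Y U) : IsHaantjes L := by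
  refine isHaantjes_of_exists_chart fun x₀ => ?_
  obtain ⟨U, Y, hx₀, ⟨-, hY⟩, -, hE⟩ := h x₀
  obtain ⟨φ, hφ, hφU, f, -, hf⟩ := hY x₀ hx₀
  refine ⟨φ, hφ, fun x hx k => ?_⟩
  obtain ⟨μ, hμ⟩ := hE x (hφU hx) k
  obtain ⟨hf0, hfk⟩ := hf k x hx
  have h1 := hL.apply_eq_smul hμ
  -- The frame vector is a nonzero multiple of the coordinate vector, so the eigenvector equation
  -- passes to the natural frame.
  rw [hfk, map_smul, smul_comm] at h1
  exact ⟨μ, smul_right_injective _ hf0 h1⟩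

end DiagonalCharts

/-! ### Eigen-frames of simple operator fields -/

section SimpleFields

variable {n : ℕ} {M : Type*} [TopologicalSpace M] [ChartedSpace (Coord n) M]
  [IsManifold (𝓡 n) ∞ M] {φ : OpenPartialHomeomorph M (Coord n)} {L : OperatorField n M}

/-- A chart can be shrunk and its coordinates permuted. -/
theorem exists_permuted_chart (hφ : φ ∈ IsManifold.maximalAtlas (𝓡 n) ∞ M) {V : Set M}
    (hV : IsOpen V) (σ : Equiv.Perm (Fin n)) :
    ∃ ψ ∈ IsManifold.maximalAtlas (𝓡 n) ∞ M, ψ.source = φ.source ∩ V ∧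
      ∀ x ∈ ψ.source, ∀ k, naturalFrame ψ k x = naturalFrame φ (σ k) x := by
  -- `P` sends the basis vector with index `σ k` to the one with index `k`, so the new `k`-th
  -- coordinate field is the old `σ k`-th one.
  let P : Coord n ≃L[ℝ] Coord n :=
    (LinearIsometryEquiv.piLpCongrLeft 2 ℝ ℝ σ.symm).toContinuousLinearEquiv
  let e : OpenPartialHomeomorph (Coord n) (Coord n) := P.toHomeomorph.toOpenPartialHomeomorph
  have hφV : φ.restr V ∈ IsManifold.maximalAtlas (𝓡 n) ∞ M :=
    restr_mem_maximalAtlas _ hφ hV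
  have he : ContDiffOn ℝ ∞ e e.source := P.contDiff.contDiffOn
  have he' : ContDiffOn ℝ ∞ e.symm e.target := P.symm.contDiff.contDiffOn
  have hψ := trans_mem_maximalAtlas hφV he he'
  have hs : (φ.restr V ≫ₕ e).source = φ.source ∩ V := by
    rw [OpenPartialHomeomorph.trans_source, φ.restr_source' V hV]
    simp [e]
  refine ⟨_, hψ, hs, fun x hx k => ?_⟩
  rw [naturalFrame_apply, ← inverse_chartDeriv hψ hx (naturalFrame φ (σ k) x),
    chartDeriv_trans hφV he hx]
  have hxφ : x ∈ φ.source := by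
    rw [hs] at hx
    exact hx.1
  have h1 : chartDeriv (φ.restr V) x (naturalFrame φ (σ k) x) = EuclideanSpace.single (σ k) 1 :=
    chartDeriv_naturalFrame hφ hxφ (σ k)
  rw [h1]
  congr 1
  change _ = fderiv ℝ P _ _
  rw [P.fderiv]
  change _ = LinearIsometryEquiv.piLpCongrLeft 2 ℝ ℝ σ.symm _
  rw [LinearIsometryEquiv.piLpCongrLeft_single, Equiv.symm_apply_apply]

variable {s : ℕ} {l : Fin s → M → ℝ} {p : Fin n → Fin s}
  (hadapt : ∀ x ∈ φ.source, ∀ i v, v ∈ genEigenspace L x (l i x) ↔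
    ∀ k, p k ≠ i → chartDeriv φ x v k = 0)

include hadapt in
/-- For a simple operator field, the blocks of an adapted chart have size one. -/
theorem IsSimpleField.injective_of_adapted (hL : IsSimpleField L)
    (hφ : φ ∈ IsManifold.maximalAtlas (𝓡 n) ∞ M)
    (hl_spec : ∀ x μ, Module.End.HasEigenvalue (L.endAt x) μ ↔ ∃ i, l i x = μ) {x : M}
    (hx : x ∈ φ.source) : Function.Injective p := by
  obtain ⟨μ, hμ, hE⟩ := hL x
  have h1 : ∀ k, ∃ j, l (p j) x = μ k := fun k => by
    obtain ⟨i, hi⟩ := (hl_spec x (μ k)).1 (hE k)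
    obtain ⟨v, hv, hv0⟩ := (hE k).exists_hasEigenvector
    have hv1 : v ∈ genEigenspace L x (l i x) := by
      rw [hi]
      exact Module.End.eigenspace_le_maxGenEigenspace hv
    -- If no coordinate belonged to the block of this eigenvalue, adaptedness would make every
    -- component of the eigenvector vanish.
    by_contra! hne
    refine hv0 ?_
    rw [← sum_chartDeriv_smul_naturalFrame hφ hx v]
    refine Finset.sum_eq_zero fun j _ => ?_
    rw [(hadapt x hx i v).1 hv1 j fun hj => hne j (hj ▸ hi), zero_smul]
  choose q hq using h1
  have hqi : Function.Injective q := fun a b hab => hμ (by rw [← hq a, ← hq b, hab])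
  -- Distinct eigenvalues force `q` to be injective, hence a permutation of the `n` indices; so each
  -- coordinate carries its own eigenvalue.
  have hqs := Finite.injective_iff_surjective.1 hqi
  intro a b hab
  obtain ⟨a, rfl⟩ := hqs a
  obtain ⟨b, rfl⟩ := hqs b
  rw [hμ (a₁ := a) (a₂ := b) (by rw [← hq a, ← hq b, hab])]

theorem contMDiffAt_chartDeriv_apply (hφ : φ ∈ IsManifold.maximalAtlas (𝓡 n) ∞ M) {X : VField n M}
    {U : Set M} (hU : IsOpen U) (hX : SmoothOn X U) {x : M} (hx : x ∈ φ.source) (hxU : x ∈ U)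
    (j : Fin n) : ContMDiffAt (𝓡 n) 𝓘(ℝ, ℝ) ∞ (fun y => chartDeriv φ y (X y) j) x := by
  have h1 : ContDiffAt ℝ ∞ (pushField φ X) (φ x) :=
    contDiffAt_pushField hφ (φ.map_source hx)
      (by rw [φ.left_inv hx]; exact hX.contMDiffAt (hU.mem_nhds hxU))
  have h2 : ContDiffAt ℝ ∞ (fun y => pushField φ X y j) (φ x) :=
    (EuclideanSpace.proj j : Coord n →L[ℝ] ℝ).contDiff.contDiffAt.comp _ h1
  refine (h2.contMDiffAt.comp x (contMDiffAt_of_mem_maximalAtlas hφ hx)).congr_of_eventuallyEq ?_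
  filter_upwards [φ.open_source.mem_nhds hx] with y hy
  exact congrArg (fun v : Coord n => v j) (pushField_apply X hy).symm

include hadapt in
/-- Near each point, an eigen-frame of a simple operator field is equivalent to the natural frame
of a chart, provided adapted charts exist. -/
theorem IsSimpleField.exists_chart_equivFrames (hL : IsSimpleField L)
    (hφ : φ ∈ IsManifold.maximalAtlas (𝓡 n) ∞ M)
    (hl_spec : ∀ x μ, Module.End.HasEigenvalue (L.endAt x) μ ↔ ∃ i, l i x = μ) {U : Set M}
    {Y : Fin n → VField n M} (hY : IsEigenFrame L Y U) {x : M} (hxU : x ∈ U)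
    (hx : x ∈ φ.source) :
    ∃ ψ : OpenPartialHomeomorph M (Coord n), IsChartAt ψ x ∧ ψ.source ⊆ U ∧
      EquivFrames Y (naturalFrame ψ) ψ.source := by
  obtain ⟨hF, hE⟩ := hY
  have hp := hL.injective_of_adapted hadapt hφ hl_spec hx
  -- Since the blocks are singletons, an eigenvector has at most one nonzero component.
  have hsupp : ∀ y ∈ φ.source, y ∈ U → ∀ k j j', chartDeriv φ y (Y k y) j ≠ 0 →
      chartDeriv φ y (Y k y) j' ≠ 0 → j = j' := by
    intro y hy hyU k j j' hj hj'
    obtain ⟨μ, hμ⟩ := hE y hyU k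
    obtain ⟨i, rfl⟩ := (hl_spec y μ).1 (Module.End.hasEigenvalue_of_hasEigenvector hμ)
    have h1 := (hadapt y hy i (Y k y)).1 (Module.End.eigenspace_le_maxGenEigenspace hμ.1)
    exact hp ((not_imp_comm.1 (h1 j) hj).trans (not_imp_comm.1 (h1 j') hj').symm)
  have hexp : ∀ y ∈ φ.source, y ∈ U → ∀ k j, chartDeriv φ y (Y k y) j ≠ 0 →
      Y k y = chartDeriv φ y (Y k y) j • naturalFrame φ j y := by
    intro y hy hyU k j hj
    conv_lhs => rw [← sum_chartDeriv_smul_naturalFrame hφ hy (Y k y)]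
    refine Finset.sum_eq_single j (fun j' _ hj' => ?_) fun h => absurd (Finset.mem_univ j) h
    rw [not_imp_comm.1 (hsupp y hy hyU k j' j · hj) hj', zero_smul]
  have h1 : ∀ k, ∃ j, chartDeriv φ x (Y k x) j ≠ 0 := fun k => by
    by_contra! hne
    refine (hF.linearIndependent x hxU).ne_zero k ?_
    rw [← sum_chartDeriv_smul_naturalFrame hφ hx (Y k x)]
    exact Finset.sum_eq_zero fun j _ => by rw [hne j, zero_smul]
  -- `σ k` is the coordinate direction of `Y k` at `x`. Linear independence makes `σ` a permutation.
  choose σ hσ using h1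
  have hσi : Function.Injective σ := by
    intro a b hab
    by_contra hne
    have ha := hexp x hx hxU a _ (hσ a)
    have hb := hexp x hx hxU b _ (hσ b)
    have h2 : chartDeriv φ x (Y b x) (σ b) • Y a x
        - chartDeriv φ x (Y a x) (σ a) • Y b x = 0 := by
      generalize chartDeriv φ x (Y a x) (σ a) = ca at ha ⊢
      generalize chartDeriv φ x (Y b x) (σ b) = cb at hb ⊢
      rw [ha, hb, hab, smul_smul, smul_smul, mul_comm, sub_self]
    have h3 := Fintype.linearIndependent_iff.1 (hF.linearIndependent x hxU)
      (Pi.single a (chartDeriv φ x (Y b x) (σ b)) - Pi.single b (chartDeriv φ x (Y a x) (σ a)))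
      (by simpa [sub_smul, Finset.sum_sub_distrib, Pi.single_apply, ite_smul] using h2) a
    rw [Pi.sub_apply, Pi.single_eq_same, Pi.single_eq_of_ne hne, sub_zero] at h3
    exact hσ b h3
  let τ : Equiv.Perm (Fin n) := Equiv.ofBijective σ (Finite.injective_iff_bijective.1 hσi)
  -- By continuity the component `σ k` stays nonzero near `x`, so `Y k` retains the same coordinate
  -- direction there; that component is the smooth factor of the equivalence.
  have hev : ∀ᶠ y in 𝓝 x, y ∈ φ.source ∧ y ∈ U ∧ ∀ k, chartDeriv φ y (Y k y) (σ k) ≠ 0 := by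
    refine Filter.Eventually.and (φ.open_source.mem_nhds hx)
      (Filter.Eventually.and (hF.isOpen.mem_nhds hxU) ?_)
    exact eventually_all.2 fun k => (contMDiffAt_chartDeriv_apply hφ hF.isOpen (hF.smooth k) hx hxU
      (σ k)).continuousAt.eventually_ne (hσ k)
  obtain ⟨V, hVP, hV, hxV⟩ := eventually_nhds_iff.1 hev
  obtain ⟨ψ, hψ, hψs, hψn⟩ := exists_permuted_chart hφ hV τ
  have hψV : ψ.source ⊆ V := hψs.subset.trans inter_subset_right
  refine ⟨ψ, ⟨hψ, hψs ▸ ⟨hx, hxV⟩⟩, fun y hy => (hVP y (hψV hy)).2.1,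
    fun k y => chartDeriv φ y (Y k y) (σ k), fun k y hy => ?_, fun k y hy => ?_⟩
  · obtain ⟨h1, h2, -⟩ := hVP y (hψV hy)
    exact (contMDiffAt_chartDeriv_apply hφ hF.isOpen (hF.smooth k) h1 h2 _).contMDiffWithinAt
  · obtain ⟨h1, h2, h3⟩ := hVP y (hψV hy)
    refine ⟨h3 k, ?_⟩
    rw [hψn y hy k]
    exact hexp y h1 h2 k _ (h3 k)

end SimpleFields

end Haantjes

/-! ### The main theorem -/

theorem proposition3p4 {n : ℕ} {M : Type*} [TopologicalSpace M]
    [ChartedSpace (Haantjes.Coord n) M] [IsManifold (𝓡 n) ∞ M]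
    (L : Haantjes.OperatorField n M)
    -- the eigenvalues of `L` are real; they are given by the pointwise distinct functions `l i`
    {s : ℕ} (l : Fin s → M → ℝ)
    (hl_cont : ∀ i, Continuous (l i))
    (hl_inj : ∀ x, Function.Injective fun i => l i x)
    (h_real : ∀ x, (minpoly ℝ (L.endAt x)).Splits)
    (hl_spec : ∀ x μ, Module.End.HasEigenvalue (L.endAt x) μ ↔ ∃ i, l i x = μ)
    -- the generalized eigen-distributions have constant rank
    (r : Fin s → ℕ)
    (h_rank : ∀ i x, Module.finrank ℝ (Haantjes.genEigenspace L x (l i x)) = r i) :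
    -- vanishing Haantjes torsion gives an equivalence class of integrable generalized
    -- eigen-frames with block-diagonal form, which is diagonal if `L` is semisimple
    (Haantjes.IsHaantjes L → ∀ x₀ : M,
      ∃ (φ : OpenPartialHomeomorph M (Haantjes.Coord n)) (p : Fin n → Fin s),
        Haantjes.IsChartAt φ x₀ ∧ Monotone p ∧
        Haantjes.IsFrame (Haantjes.naturalFrame φ) φ.source ∧
        ∀ Y : Fin n → Haantjes.VField n M,
          Haantjes.EquivFrames Y (Haantjes.naturalFrame φ) φ.source →
            Haantjes.IsIntegrableFrame Y φ.source ∧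
            Haantjes.IsGenEigenFrame L Y φ.source ∧
            (∀ x ∈ φ.source, ∀ i,
              Submodule.span ℝ ((fun k => Y k x) '' {k | p k = i})
                = Haantjes.genEigenspace L x (l i x)) ∧
            Haantjes.IsBlockDiagonalIn L Y φ.source p ∧
            (Haantjes.IsSemisimpleField L → Haantjes.IsDiagonalIn L Y φ.source)) ∧
    -- for semisimple `L`, vanishing of the Haantjes torsion is necessary and sufficient
    (Haantjes.IsSemisimpleField L →
      (Haantjes.IsHaantjes L ↔
        ∀ x₀ : M, ∃ φ : OpenPartialHomeomorph M (Haantjes.Coord n),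
          Haantjes.IsChartAt φ x₀ ∧
          Haantjes.IsDiagonalIn L (Haantjes.naturalFrame φ) φ.source) ∧
      (Haantjes.IsHaantjes L ↔
        ∀ x₀ : M, ∃ (U : Set M) (Y : Fin n → Haantjes.VField n M), x₀ ∈ U ∧
          Haantjes.IsIntegrableFrame Y U ∧ Haantjes.IsGenEigenFrame L Y U)) ∧
    -- for simple `L` with vanishing Haantjes torsion, every eigen-frame is integrable
    (Haantjes.IsSimpleField L → Haantjes.IsHaantjes L →
      ∀ (U : Set M) (Y : Fin n → Haantjes.VField n M),
        Haantjes.IsEigenFrame L Y U → Haantjes.IsIntegrableFrame Y U) := by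
  have hpart := fun (hL : Haantjes.IsHaantjes L) x₀ =>
    Haantjes.exists_adapted_chart hl_cont hl_inj h_real hl_spec h_rank hL x₀
  have hdiag : Haantjes.IsSemisimpleField L → Haantjes.IsHaantjes L → ∀ x₀ : M,
      ∃ φ : OpenPartialHomeomorph M (Haantjes.Coord n), Haantjes.IsChartAt φ x₀ ∧
        Haantjes.IsDiagonalIn L (Haantjes.naturalFrame φ) φ.source := fun hs hL x₀ => by
    obtain ⟨φ, p, hφ, -, hadapt⟩ := hpart hL x₀
    exact ⟨φ, hφ, (Haantjes.EquivFrames.refl _ _).isDiagonalIn hφ.1 hadapt hs⟩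
  have hframe : Haantjes.IsHaantjes L → ∀ x₀ : M, ∃ (U : Set M) (Y : Fin n → Haantjes.VField n M),
      x₀ ∈ U ∧ Haantjes.IsIntegrableFrame Y U ∧ Haantjes.IsGenEigenFrame L Y U := fun hL x₀ => by
    obtain ⟨φ, p, hφ, -, hadapt⟩ := hpart hL x₀
    have hrefl := Haantjes.EquivFrames.refl (Haantjes.naturalFrame φ) φ.source
    exact ⟨_, _, hφ.2, hrefl.isIntegrableFrame hφ.1, hrefl.isGenEigenFrame hφ.1 hadapt⟩
  refine ⟨fun hL x₀ => ?_, fun hs => ⟨⟨hdiag hs, fun h => ?_⟩, hframe, hs.isHaantjes⟩,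
    fun hs hL U Y hY => ⟨hY.1, fun x hx => ?_⟩⟩
  · obtain ⟨φ, p, hφ, hp, hadapt⟩ := hpart hL x₀
    exact ⟨φ, p, hφ, hp, Haantjes.isFrame_naturalFrame hφ.1, fun Y hY =>
      ⟨hY.isIntegrableFrame hφ.1, hY.isGenEigenFrame hφ.1 hadapt,
        fun x hx i => hY.span_eq_genEigenspace hφ.1 hadapt hx i,
        hY.isBlockDiagonalIn hφ.1 hadapt, hY.isDiagonalIn hφ.1 hadapt⟩⟩
  · refine Haantjes.isHaantjes_of_exists_chart fun x₀ => ?_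
    obtain ⟨φ, hφ, hd⟩ := h x₀
    exact ⟨φ, hφ, fun x hx k => hd.exists_apply_eq_smul hx k⟩
  · obtain ⟨φ, p, hφ, -, hadapt⟩ := hpart hL x
    exact hs.exists_chart_equivFrames hadapt hφ.1 hl_spec hY hx hφ.2
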